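/- \textbf{Setting.} Let $AP$ be a set of atomic propositions. A \emph{discounting function} is a strictly decreasing $\eta:\mathbb N\to[0,1]$ with $\lim_{i\to\infty}\eta(i)=0$. A \emph{propositional quality operator} is a function $f:[0,1]^k\to[0,1]$, $k\in\mathbb N$; let $\mathcal F_{\mathrm{mc}}$ be the set of those that are monotone (coordinatewise non-decreasing) and continuous, for example the average $v_1\oplus v_2=(v_1+v_2)/2$. For a set $\mathcal D$ of discounting functions and a set $\mathcal F$ of propositional quality operators, the formulas of $\mathrm{LTL}^{\mathrm{disc}}[\mathcal D,\mathcal F]$ are $$\varphi ::= \mathtt{True}\mid p\mid\neg\varphi\mid\varphi\wedge\varphi\mid \mathsf X\varphi\mid\varphi\,\mathsf U\,\varphi\mid\varphi\,\mathsf U_\eta\,\varphi\mid f(\varphi,\dots,\varphi)\qquad(p\in AP,\ \eta\in\mathcal D,\ f\in\mathcal F).$$ The truth value $[\![\pi,\varphi]\!]\in[0,1]$ in a computation $\pi=\pi_0\pi_1\ldots\in(\mathcal P(AP))^\omega$, with suffixes $\pi^i=\pi_i\pi_{i+1}\ldots$, is given by: $[\![\pi,\mathtt{True}]\!]=1$;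 $[\![\pi,p]\!]=1$ if $p\in\pi_0$ and $0$ otherwise; $[\![\pi,\neg\varphi]\!]=1-[\![\pi,\varphi]\!]$; $[\![\pi,\varphi_1\wedge\varphi_2]\!]=\min\{[\![\pi,\varphi_1]\!],[\![\pi,\varphi_2]\!]\}$; $[\![\pi,\mathsf X\varphi]\!]=[\![\pi^1,\varphi]\!]$; $$[\![\pi,\varphi_1\mathsf U\varphi_2]\!]=\sup_{i\in\mathbb N}\min\Bigl\{[\![\pi^i,\varphi_2]\!],\min_{0\le j<i}[\![\pi^j,\varphi_1]\!]\Bigr\},$$ $$[\![\pi,\varphi_1\mathsf U_\eta\varphi_2]\!]=\sup_{i\in\mathbb N}\min\Bigl\{\eta(i)[\![\pi^i,\varphi_2]\!],\min_{0\le j<i}\eta(j)[\![\pi^j,\varphi_1]\!]\Bigr\};$$ and $[\![\pi,f(\varphi_1,\dots,\varphi_k)]\!]=f([\![\pi,\varphi_1]\!],\dots,[\![\pi,\varphi_k]\!])$. A \emph{Kripke structure} $\mathcal K=(W,R,\lambda)$ consists of a finite nonempty set $W$ of states, a left-total relation $R\subseteq W^2$ and a labeling $\lambda:W\to\mathcal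 P(AP)$. A \emph{path} is an infinite sequence $\xi=s_0s_1\dots$ with $(s_i,s_{i+1})\in R$ for all $i$ (any $s_0\in W$ is allowed), and $[\![\xi,\varphi]\!]:=[\![\lambda(s_0)\lambda(s_1)\dots,\varphi]\!]$. The \emph{near-optimal scheduling problem} for $\mathrm{LTL}^{\mathrm{disc}}[\mathcal D,\mathcal F]$ is: given a Kripke structure $\mathcal K$, a formula $\varphi$ and a real margin $\varepsilon\in(0,1)$, find a path $\xi_0$ of $\mathcal K$ such that $[\![\xi_0,\varphi]\!]\ge\sup_{\xi\in\mathrm{path}(\mathcal K)}[\![\xi,\varphi]\!]-\varepsilon$. Since $\eta$, $f$ and $\varepsilon$ are arbitrary real objects, an algorithm receives them as is usual in computable analysis, by names: the finite part of the input codes $\mathcal K$ (its transitions, and its labels with the atomic propositions that occur in $\varphi$) and the syntax tree of $\varphi$; and for every $m\in\mathbb N$ the algorithm may query, with error at most $2^{-m}$, the values $\eta(n)$ ($n\in\mathbb N$) of each $\eta$ occurring in $\varphi$, the values $f(a_1/2^m,\dots,a_k/2^m)$ ($0\le a_l\le 2^m$ integers) of each $f$ occurring in $\varphi$, and $\varepsilon$.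 \textbf{Theorem.} Let $\mathcal D$ be any set of discounting functions and let $\mathcal F\subseteq\mathcal F_{\mathrm{mc}}$ be any set of monotone and continuous propositional quality operators. Then the near-optimal scheduling problem for $\mathrm{LTL}^{\mathrm{disc}}[\mathcal D,\mathcal F]$ is decidable: there is an algorithm that, on every presentation of an instance $(\mathcal K,\varphi,\varepsilon)$, halts and outputs finite words $u,v$ over $W$, $v$ nonempty, such that $\xi_0=uv^\omega$ is a path of $\mathcal K$ with $$[\![\xi_0,\varphi]\!]\ \ge\ \sup_{\xi\in\mathrm{path}(\mathcal K)}[\![\xi,\varphi]\!]-\varepsilon .$$ -/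

import Mathlib

open scoped unitInterval

universe u v

namespace DiscLTL

/-! ### The logic -/

/-- A discounting function: a strictly decreasing `η : ℕ → [0,1]` that tends to `0`. -/
structure DiscountingFunction where
  toFun : ℕ → I
  strictAnti : StrictAnti toFun
  tendsto_zero : Filter.Tendsto toFun Filter.atTop (nhds 0)

/-- A propositional quality operator: a function `[0,1]^k → [0,1]`, for some arity `k`. -/
structure QualityOperator where
  arity : ℕ
  toFun : (Fin arity → I) → I

/-- The set of monotone and continuous propositional quality operators. -/
def monotoneContinuousOperators : Set QualityOperator :=
  {f | Monotone f.toFun ∧ Continuous f.toFun}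

/-- The formulas of `LTLdisc[D, F]` over the atomic propositions `AP`. -/
inductive Formula (AP : Type u) (D : Set DiscountingFunction) (F : Set QualityOperator) :
    Type u
  | tt : Formula AP D F
  | atom (p : AP) : Formula AP D F
  | neg (φ : Formula AP D F) : Formula AP D F
  | and (φ ψ : Formula AP D F) : Formula AP D F
  | next (φ : Formula AP D F) : Formula AP D F
  | untl (φ ψ : Formula AP D F) : Formula AP D F
  | duntl (η : D) (φ ψ : Formula AP D F) : Formula AP D F
  | op (f : F) (φs : Fin f.1.arity → Formula AP D F) : Formula AP D F

/-- A computation: an infinite word over the powerset of `AP`. -/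
abbrev Computation (AP : Type u) : Type u := ℕ → Set AP

/-- The suffix of a computation that starts from its `i`-th element. -/
def Computation.suffix {AP : Type u} (π : Computation AP) (i : ℕ) : Computation AP :=
  fun j => π (i + j)

open scoped Classical in
/-- The truth value of a formula in a computation. Suprema and infima are those of the complete
lattice `[0,1]`; in particular the infimum of the empty family is `1`. -/
noncomputable def truthValue {AP : Type u} {D : Set DiscountingFunction}
    {F : Set QualityOperator} : Formula AP D F → Computation AP → I
  | .tt, _ => 1
  | .atom p, π => if p ∈ π 0 then 1 else 0
  | .neg φ, π => unitInterval.symm (truthValue φ π)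
  | .and φ ψ, π => min (truthValue φ π) (truthValue ψ π)
  | .next φ, π => truthValue φ (π.suffix 1)
  | .untl φ ψ, π =>
      ⨆ i : ℕ, min (truthValue ψ (π.suffix i)) (⨅ j : Fin i, truthValue φ (π.suffix j))
  | .duntl η φ ψ, π =>
      ⨆ i : ℕ, min (η.1.toFun i * truthValue ψ (π.suffix i))
        (⨅ j : Fin i, η.1.toFun j * truthValue φ (π.suffix j))
  | .op f φs, π => f.1.toFun fun k => truthValue (φs k) π

/-! ### Kripke structures -/

/-- A Kripke structure over `AP` with the finite set `W` of states. -/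
structure KripkeStructure (AP : Type u) (W : Type v) where
  finite : Finite W
  rel : W → W → Prop
  leftTotal : ∀ s, ∃ s', rel s s'
  label : W → Set AP

/-- The set of paths of a Kripke structure. A path may start in any state. -/
def KripkeStructure.paths {AP : Type u} {W : Type v} (K : KripkeStructure AP W) :
    Set (ℕ → W) :=
  {ξ | ∀ i, K.rel (ξ i) (ξ (i + 1))}

/-- The truth value of a formula in a path: its truth value in the induced computation. -/
noncomputable def KripkeStructure.value {AP : Type u} {W : Type v} (K : KripkeStructure AP W)
    {D : Set DiscountingFunction} {F : Set QualityOperator} (φ : Formula AP D F)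
    (ξ : ℕ → W) : I :=
  truthValue φ fun i => K.label (ξ i)

/-- `ξ₀` solves the near-optimal scheduling problem for `K`, `φ` and the margin `ε`. -/
def IsNearOptimal {AP : Type u} {W : Type v} (K : KripkeStructure AP W)
    {D : Set DiscountingFunction} {F : Set QualityOperator} (φ : Formula AP D F) (ε : ℝ)
    (ξ₀ : ℕ → W) : Prop :=
  ξ₀ ∈ K.paths ∧ ((⨆ ξ : K.paths, K.value φ ξ.1 : I) : ℝ) - ε ≤ (K.value φ ξ₀ : ℝ)

/-! ### Inputs and outputs of algorithms

Real numbers and real functions are given to an algorithm in the way that is standard in computable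
analysis: by a name, that is, by an oracle that answers every query for an approximation.
Everything else is given by a finite code. -/

/-- A query to the oracle, for an approximation up to `2⁻ᵏ` of
* `eta i n k` : the value at `n` of the discounting function in slot `i`;
* `opr j a k` : the value at the dyadic point `(a₁/2ᵏ, a₂/2ᵏ, …)` of the operator in slot `j`;
* `margin k` : the margin. -/
abbrev Query : Type := (ℕ × ℕ × ℕ) ⊕ (ℕ × List ℕ × ℕ) ⊕ ℕ

abbrev Query.eta (i n k : ℕ) : Query := Sum.inl (i, n, k)

abbrev Query.opr (j : ℕ) (a : List ℕ) (k : ℕ) : Query := Sum.inr (Sum.inl (j, a, k))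

abbrev Query.margin (k : ℕ) : Query := Sum.inr (Sum.inr k)

/-- An oracle answers (the number of) every query by a natural number. -/
abbrev Oracle : Type := ℕ → ℕ

/-- The number `b / 2ᵏ`, where `b` is the answer of the oracle to the query `q`, is an
approximation of `x` up to `2⁻ᵏ`. -/
def Oracle.Approximates (g : Oracle) (q : Query) (k : ℕ) (x : ℝ) : Prop :=
  |x - (g (Encodable.encode q) : ℝ) / 2 ^ k| ≤ 1 / 2 ^ k

/-- Slot `i` of the oracle holds a name of the discounting function `η`. -/
def Oracle.NamesDiscounting (g : Oracle) (i : ℕ) (η : DiscountingFunction) : Prop :=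
  ∀ n k : ℕ, g.Approximates (.eta i n k) k (η.toFun n)

/-- The point `(a₁/2ᵏ, …, aᵣ/2ᵏ)` of the cube `[0,1]^r`. -/
noncomputable def dyadicPoint {r : ℕ} (k : ℕ) (a : Fin r → Fin (2 ^ k + 1)) : Fin r → I :=
  fun l => ⟨(a l : ℕ) / 2 ^ k, by positivity, by
    rw [div_le_one (by positivity)]
    exact_mod_cast Nat.lt_succ_iff.mp (a l).isLt⟩

/-- Slot `j` of the oracle holds a name of the operator `f`. -/
def Oracle.NamesOperator (g : Oracle) (j : ℕ) (f : QualityOperator) : Prop :=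
  ∀ (k : ℕ) (a : Fin f.arity → Fin (2 ^ k + 1)),
    g.Approximates (.opr j (List.ofFn fun l => (a l : ℕ)) k) k (f.toFun (dyadicPoint k a))

/-- The oracle holds a name of the margin `ε`. -/
def Oracle.NamesMargin (g : Oracle) (ε : ℝ) : Prop :=
  ∀ k : ℕ, g.Approximates (.margin k) k ε

/-- The code of a Kripke structure with states numbered `0, …, n - 1` is a list of length `n`. Its
`s`-th entry consists of the list of (the numbers of) the successors of the state `s`, and of the
list of (the numbers of) the atomic propositions that hold in `s`. -/
abbrev KripkeCode : Type := List (List ℕ × List ℕ)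

/-- `c` codes the transitions of `K` with respect to the numbering `st` of the states. -/
def CodesTransitions {AP : Type u} {W : Type v} (K : KripkeStructure AP W) (c : KripkeCode)
    (st : W ≃ Fin c.length) : Prop :=
  ∀ s s', K.rel s s' ↔ (st s' : ℕ) ∈ (c.get (st s)).1

/-- The number `i` stands for the atomic proposition `p`: the code `c` lists `i` for exactly those
states that are labeled with `p`. -/
def CodesAtom {AP : Type u} {W : Type v} (K : KripkeStructure AP W) (c : KripkeCode)
    (st : W ≃ Fin c.length) (p : AP) (i : ℕ) : Prop :=
  ∀ s, p ∈ K.label s ↔ i ∈ (c.get (st s)).2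

/-- `m` is a Gödel number of the given formula, in which atomic propositions are replaced with
numbers that stand for them, and discounting functions and quality operators with the slots of
the oracle that hold their names. -/
def CodesFormula {AP : Type u} {W : Type v} {D : Set DiscountingFunction}
    {F : Set QualityOperator} (K : KripkeStructure AP W) (c : KripkeCode)
    (st : W ≃ Fin c.length) (g : Oracle) : Formula AP D F → ℕ → Prop
  | .tt, m => m = Nat.pair 0 0
  | .atom p, m => ∃ i, CodesAtom K c st p i ∧ m = Nat.pair 1 i
  | .neg φ, m => ∃ a, CodesFormula K c st g φ a ∧ m = Nat.pair 2 a
  | .and φ ψ, m => ∃ a b, CodesFormula K c st g φ a ∧ CodesFormula K c st g ψ b ∧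
      m = Nat.pair 3 (Nat.pair a b)
  | .next φ, m => ∃ a, CodesFormula K c st g φ a ∧ m = Nat.pair 4 a
  | .untl φ ψ, m => ∃ a b, CodesFormula K c st g φ a ∧ CodesFormula K c st g ψ b ∧
      m = Nat.pair 5 (Nat.pair a b)
  | .duntl η φ ψ, m => ∃ i a b, g.NamesDiscounting i η.1 ∧ CodesFormula K c st g φ a ∧
      CodesFormula K c st g ψ b ∧ m = Nat.pair 6 (Nat.pair i (Nat.pair a b))
  | .op f φs, m => ∃ (j : ℕ) (a : Fin f.1.arity → ℕ), g.NamesOperator j f.1 ∧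
      (∀ k, CodesFormula K c st g (φs k) (a k)) ∧
      m = Nat.pair 7 (Nat.pair j (Encodable.encode (List.ofFn a)))

/-- A finite description of an ultimately periodic sequence `u v v v …` of state numbers. -/
abbrev Lasso : Type := List ℕ × List ℕ

/-- `o` describes the sequence `ξ` of states: `ξ = u v v v …`, where `o = (u, v)` and `v` is not
empty. -/
def Lasso.Describes {W : Type v} {n : ℕ} (st : W ≃ Fin n) (o : Lasso) (ξ : ℕ → W) : Prop :=
  o.2 ≠ [] ∧
    (∀ i, i < o.1.length → o.1[i]? = some (st (ξ i) : ℕ)) ∧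
    ∀ i, o.2[i % o.2.length]? = some (st (ξ (o.1.length + i)) : ℕ)

/-! ### Algorithms with oracle -/

/-- The finite part of the input: codes of a Kripke structure and of a formula. -/
abbrev Input : Type := KripkeCode × ℕ

/-- The answers of the oracle to the first `n` queries. -/
def Oracle.prefix (g : Oracle) (n : ℕ) : List ℕ := (List.range n).map g

/-- An algorithm with oracle, given by a computable associate: on a finite input, the algorithm
reads longer and longer finite initial segments of the oracle. For each of these it decides, by a
computable function, whether to read on (`none`) or to halt with an output. -/
structure OracleAlgorithm where
  step : Input × List ℕ → Option Lasso
  computable : Computable step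

/-- On the input `x` and with the oracle `g`, the algorithm `M` halts with the output `o`. -/
def OracleAlgorithm.Outputs (M : OracleAlgorithm) (x : Input) (g : Oracle) (o : Lasso) : Prop :=
  ∃ n, M.step (x, g.prefix n) = some o ∧ ∀ m < n, M.step (x, g.prefix m) = none

/-- The algorithm `M` solves the near-optimal scheduling problem for `LTLdisc[D, F]`. On every
presentation of a (nonempty) Kripke structure `K`, a formula `φ` and a margin `ε ∈ (0,1)`, it halts
with the description of an ultimately periodic path that is optimal up to `ε`. -/
def OracleAlgorithm.SolvesScheduling (M : OracleAlgorithm) (AP : Type u)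
    (D : Set DiscountingFunction) (F : Set QualityOperator) : Prop :=
  ∀ (W : Type v) [Nonempty W] (K : KripkeStructure AP W) (φ : Formula AP D F) (ε : ℝ),
    0 < ε → ε < 1 →
    ∀ (c : KripkeCode) (st : W ≃ Fin c.length) (m : ℕ) (g : Oracle),
      CodesTransitions K c st → CodesFormula K c st g φ m → g.NamesMargin ε →
      ∃ o : Lasso, M.Outputs (c, m) g o ∧
        ∃ ξ₀ : ℕ → W, o.Describes st ξ₀ ∧ IsNearOptimal K φ ε ξ₀

end DiscLTL

/-!
The truth value of a formula is approximated by intervals with endpoints in `{0, …, 2ᵏ} / 2ᵏ`.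
They are computed from the known initial segment of the oracle (`cell`, `sem`): a discounted until
is expanded up to the horizon `k`, beyond which it is worth at most `η k`; a monotone operator is
evaluated at the lower and at the upper endpoints of the intervals of its arguments; and a missing
answer counts as the trivial bound. Hence the intervals are sound for every initial segment of the
oracle (`sem_sound`). Since the operators are uniformly continuous and discounting functions tend
to zero, the intervals become arbitrarily narrow, uniformly in all words, when first the known
segment and then `k` tend to infinity (`sem_converges`).

For fixed `k` the interval semantics has finitely many values, so that it behaves like linear
temporal logic. The type of a position of a path consists of the state and of the intervals of all
subformulas at the next few positions; there are finitely many types. Every path has the same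
interval as some lasso whose size is bounded in terms of the number of types (`exists_mem_lassos`).
The lasso follows the path up to a type that recurs, then repeats a closed walk through all types
that recur, both shortened by cutting out cycles. That all recurring types are visited guarantees
that no until formula is postponed forever (`untl_comp_eq`).

Therefore the algorithm evaluates the formula on all lassos up to the bound, and outputs a
lasso whose lower endpoint, increased by the margin, reaches the upper endpoints of all others.
Such a lasso is near-optimal among all paths (`isNearOptimal_of_isCertified`), and one is found as
soon as the intervals are narrower than the margin (`exists_schedulingStep_isSome`).
-/

namespace DiscLTL

/-! ### Interval evaluation of formulas -/

/-- Truth values are approximated by pairs of naturals: at precision `k` the pair `(a, b)` stands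
for the interval `[a / 2ᵏ, b / 2ᵏ]`. -/
abbrev Interval : Type := ℕ × ℕ

/-- A lower bound, in units of `2⁻ᵏ`, of the number that is named by the answer to the query `q`.
Here `l` is the known initial segment of the oracle; an answer outside of it counts as `0`, so that
the bound is valid for every `l`. -/
def loBound (l : List ℕ) (k : ℕ) (q : Query) : ℕ :=
  min (2 ^ k) (l.getD (Encodable.encode q) 0 - 1)

/-- An upper bound, in units of `2⁻ᵏ`, of the number that is named by the answer to the query `q`.
An answer outside of the initial segment `l` counts as `2ᵏ`, so that the bound is valid for
every `l`. -/
def hiBound (l : List ℕ) (k : ℕ) (q : Query) : ℕ :=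
  min (2 ^ k) (l.getD (Encodable.encode q) (2 ^ k) + 1)

/-- A lower bound for the product of `η n`, where slot `i` names `η`, and `x / 2ᵏ`. -/
def loScale (l : List ℕ) (k i n x : ℕ) : ℕ :=
  loBound l k (.eta i n k) * x / 2 ^ k

/-- An upper bound for the product of `η n`, where slot `i` names `η`, and `x / 2ᵏ`. The added `1`
compensates for the division, which rounds down. -/
def hiScale (l : List ℕ) (k i n x : ℕ) : ℕ :=
  min (2 ^ k) (hiBound l k (.eta i n k) * x / 2 ^ k + 1)

/-- The expansion of an until operator up to the horizon `N`:
`max (a 0) (min (b 0) (max (a 1) (min (b 1) (… base))))`. -/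
def unroll (a b : ℕ → ℕ) (base N : ℕ) : ℕ :=
  (List.range N).foldr (fun n r => max (a n) (min (b n) r)) base

/-- The interval of the formula with Gödel number `m` at one position of a word. The list `lab`
holds the labels of the position, `acc m' n` is the interval of the subformula `m'` at the `n`-th
position from here, and `U` interprets the until operator. Tags from `7` on are read as those of
quality operators. -/
def cell (U : (ℕ → ℕ) → (ℕ → ℕ) → ℕ) (l : List ℕ) (k : ℕ) (lab : List ℕ)
    (acc : ℕ → ℕ → Interval) (m : ℕ) : Interval :=
  if m.unpair.1 = 0 then (2 ^ k, 2 ^ k)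
  else if m.unpair.1 = 1 then if m.unpair.2 ∈ lab then (2 ^ k, 2 ^ k) else (0, 0)
  else if m.unpair.1 = 2 then
    (2 ^ k - (acc m.unpair.2 0).2, 2 ^ k - (acc m.unpair.2 0).1)
  else if m.unpair.1 = 3 then
    (min (acc m.unpair.2.unpair.1 0).1 (acc m.unpair.2.unpair.2 0).1,
      min (acc m.unpair.2.unpair.1 0).2 (acc m.unpair.2.unpair.2 0).2)
  else if m.unpair.1 = 4 then acc m.unpair.2 1
  else if m.unpair.1 = 5 then
    (U (fun n => (acc m.unpair.2.unpair.2 n).1) fun n => (acc m.unpair.2.unpair.1 n).1,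
      U (fun n => (acc m.unpair.2.unpair.2 n).2) fun n => (acc m.unpair.2.unpair.1 n).2)
  else if m.unpair.1 = 6 then
    (unroll (fun n => loScale l k m.unpair.2.unpair.1 n (acc m.unpair.2.unpair.2.unpair.2 n).1)
        (fun n => loScale l k m.unpair.2.unpair.1 n (acc m.unpair.2.unpair.2.unpair.1 n).1) 0 k,
      unroll (fun n => hiScale l k m.unpair.2.unpair.1 n (acc m.unpair.2.unpair.2.unpair.2 n).2)
        (fun n => hiScale l k m.unpair.2.unpair.1 n (acc m.unpair.2.unpair.2.unpair.1 n).2)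
        (hiBound l k (.eta m.unpair.2.unpair.1 k k)) k)
  else
    (loBound l k (.opr m.unpair.2.unpair.1
        ((Denumerable.ofNat (List ℕ) m.unpair.2.unpair.2).map fun a => (acc a 0).1) k),
      hiBound l k (.opr m.unpair.2.unpair.1
        ((Denumerable.ofNat (List ℕ) m.unpair.2.unpair.2).map fun a => (acc a 0).2) k))

/-! ### Evaluation on lassos -/

/-- The position of the lasso `(u, v)`, one of the `|u| + |v|` many, at which the `p`-th element of
`u v v v …` is found. -/
def Lasso.norm (o : Lasso) (p : ℕ) : ℕ :=
  if p < o.1.length then p else o.1.length + (p - o.1.length) % o.2.length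

/-- The `p`-th element of the sequence `u v v v …`. -/
def Lasso.word (o : Lasso) (p : ℕ) : ℕ := (o.1 ++ o.2).getD (o.norm p) 0

/-- The list of the labels of the state number `s`. -/
def labelsOf (c : KripkeCode) (s : ℕ) : List ℕ := (c.getD s ([], [])).2

/-- The list of the successors of the state number `s`. -/
def successorsOf (c : KripkeCode) (s : ℕ) : List ℕ := (c.getD s ([], [])).1

/-- The intervals of the formula number `m` at the positions of a lasso, given the list `tab` of
those of all smaller formula numbers. A proper subformula has a smaller number, so that the default
value `(0, 0)` is irrelevant. -/
def column (o : Lasso) (c : KripkeCode) (l : List ℕ) (k : ℕ) (tab : List (List Interval))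
    (m : ℕ) : List Interval :=
  (List.range (o.1.length + o.2.length)).map fun p =>
    cell (fun a b => unroll a b 0 (o.1.length + o.2.length)) l k (labelsOf c (o.word p))
      (fun m' n => (tab.getD m' []).getD (o.norm (p + n)) (0, 0)) m

/-- The columns of the formula numbers less than `m`. -/
def table (o : Lasso) (c : KripkeCode) (l : List ℕ) (k : ℕ) : ℕ → List (List Interval)
  | 0 => []
  | m + 1 => table o c l k m ++ [column o c l k (table o c l k m) m]

/-- The interval of the formula number `m` in the sequence that a lasso describes. -/
def lassoValue (o : Lasso) (c : KripkeCode) (l : List ℕ) (k m : ℕ) : Interval :=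
  ((table o c l k (m + 1)).getD m []).getD 0 (0, 0)

/-! ### The algorithm -/

/-- The words of length at most `B` over the alphabet `{0, …, n - 1}`. -/
def words (n : ℕ) : ℕ → List (List ℕ)
  | 0 => [[]]
  | B + 1 => [] :: (words n B).flatMap fun w => (List.range n).map fun a => a :: w

/-- The lasso describes a sequence whose successive elements are linked by transitions of `c`. -/
def Lasso.IsPath (o : Lasso) (c : KripkeCode) : Prop :=
  o.2.length ≠ 0 ∧
    ∀ i < o.1.length + o.2.length, o.word (i + 1) ∈ successorsOf c (o.word i)

instance (o : Lasso) (c : KripkeCode) : Decidable (o.IsPath c) := by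
  unfold Lasso.IsPath; infer_instance

/-- The paths of `c` that are described by words of length at most `B`. -/
def lassos (c : KripkeCode) (B : ℕ) : List Lasso :=
  ((words c.length B).flatMap fun u => (words c.length B).map fun v => (u, v)).filter
    fun o => o.IsPath c

/-- The number of types: a type consists of a state and of the intervals of the
formulas with numbers at most `m` at the `k + 1` positions from here on. -/
def typeCount (c : KripkeCode) (m k : ℕ) : ℕ :=
  c.length * ((2 ^ k + 1) * (2 ^ k + 1)) ^ ((m + 1) * (k + 1))

/-- A bound for the lengths of both parts of a lasso that is equivalent to a given path. -/
def lassoBound (c : KripkeCode) (m k : ℕ) : ℕ := typeCount c m k * 2 ^ typeCount c m k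

/-- With precision `k`, no lasso in the list `L` can be better than `o` by more than the margin. -/
def IsCertified (c : KripkeCode) (m : ℕ) (l : List ℕ) (k : ℕ) (L : List Lasso) (o : Lasso) :
    Prop :=
  ∀ o' ∈ L, (lassoValue o' c l k m).2 ≤ (lassoValue o c l k m).1 + loBound l k (.margin k)

instance (c : KripkeCode) (m : ℕ) (l : List ℕ) (k : ℕ) (L : List Lasso) (o : Lasso) :
    Decidable (IsCertified c m l k L o) := by
  unfold IsCertified; infer_instance

/-- The step function of the algorithm. The precision depends on the number of known answers in
such a way that every precision is used for arbitrarily long initial segments of the oracle. -/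
def schedulingStep (x : Input × List ℕ) : Option Lasso :=
  ((lassos x.1.1 (lassoBound x.1.1 x.1.2 x.2.length.unpair.1)).filter fun o =>
    IsCertified x.1.1 x.1.2 x.2 x.2.length.unpair.1
      (lassos x.1.1 (lassoBound x.1.1 x.1.2 x.2.length.unpair.1)) o).head?

/-! ### Computability of the algorithm -/

section Computability

open Primrec

variable {α : Type} [Primcodable α]

theorem primrec_pow : Primrec₂ ((· ^ ·) : ℕ → ℕ → ℕ) :=
  Primrec₂.unpaired'.1 Nat.Primrec.pow

theorem primrec_list_getD {β : Type*} [Primcodable β] {f : α → List β} {n : α → ℕ} {d : α → β}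
    (hf : Primrec f) (hn : Primrec n) (hd : Primrec d) :
    Primrec fun z => (f z).getD (n z) (d z) :=
  (option_getD.comp (list_getElem?.comp hf hn) hd).of_eq fun z => by
    simp [List.getD_eq_getElem?_getD]

variable {l : α → List ℕ} {k i n x m : α → ℕ}

theorem primrec_two_pow (hk : Primrec k) : Primrec fun z => 2 ^ k z :=
  primrec_pow.comp (const 2) hk

theorem primrec_loBound {q : α → Query} (hl : Primrec l) (hk : Primrec k) (hq : Primrec q) :
    Primrec fun z => loBound (l z) (k z) (q z) :=
  nat_min.comp (primrec_two_pow hk)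
    (nat_sub.comp (primrec_list_getD hl (Primrec.encode.comp hq) (const 0)) (const 1))

theorem primrec_hiBound {q : α → Query} (hl : Primrec l) (hk : Primrec k) (hq : Primrec q) :
    Primrec fun z => hiBound (l z) (k z) (q z) :=
  nat_min.comp (primrec_two_pow hk) (succ.comp
    (primrec_list_getD hl (Primrec.encode.comp hq) (primrec_two_pow hk)))

theorem primrec_query_eta (hi : Primrec i) (hn : Primrec n) (hk : Primrec k) :
    Primrec fun z => Query.eta (i z) (n z) (k z) :=
  sumInl.comp (hi.pair (hn.pair hk))

theorem primrec_query_opr {a : α → List ℕ} (hi : Primrec i) (ha : Primrec a) (hk : Primrec k) :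
    Primrec fun z => Query.opr (i z) (a z) (k z) :=
  sumInr.comp (sumInl.comp (hi.pair (ha.pair hk)))

theorem primrec_query_margin (hk : Primrec k) : Primrec fun z => Query.margin (k z) :=
  sumInr.comp (sumInr.comp hk)

theorem primrec_loScale (hl : Primrec l) (hk : Primrec k) (hi : Primrec i) (hn : Primrec n)
    (hx : Primrec x) : Primrec fun z => loScale (l z) (k z) (i z) (n z) (x z) :=
  nat_div.comp (nat_mul.comp (primrec_loBound hl hk (primrec_query_eta hi hn hk)) hx)
    (primrec_two_pow hk)

theorem primrec_hiScale (hl : Primrec l) (hk : Primrec k) (hi : Primrec i) (hn : Primrec n)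
    (hx : Primrec x) : Primrec fun z => hiScale (l z) (k z) (i z) (n z) (x z) :=
  nat_min.comp (primrec_two_pow hk) (succ.comp
    (nat_div.comp (nat_mul.comp (primrec_hiBound hl hk (primrec_query_eta hi hn hk)) hx)
      (primrec_two_pow hk)))

theorem primrec_unroll {a b : α → ℕ → ℕ} {base N : α → ℕ} (ha : Primrec fun z : α × ℕ => a z.1 z.2)
    (hb : Primrec fun z : α × ℕ => b z.1 z.2) (hbase : Primrec base) (hN : Primrec N) :
    Primrec fun z => unroll (a z) (b z) (base z) (N z) :=
  list_foldr (h := fun z (p : ℕ × ℕ) => max (a z p.1) (min (b z p.1) p.2))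
    (list_range.comp hN) hbase
    (nat_max.comp (ha.comp (fst.pair (fst.comp snd)))
      (nat_min.comp (hb.comp (fst.pair (fst.comp snd))) (snd.comp snd)))

theorem primrecPred_mem {β : Type*} [Primcodable β] {f : α → β} {g : α → List β}
    (hf : Primrec f) (hg : Primrec g) : PrimrecPred fun z => f z ∈ g z :=
  (PrimrecRel.comp (PrimrecRel.exists_mem_list (R := fun a b : β => a = b) Primrec.eq) hg hf).of_eq
    fun z => by simp

theorem primrec_cell {N : α → ℕ} {lab : α → List ℕ} {acc : α → ℕ → ℕ → Interval}
    (hN : Primrec N) (hl : Primrec l) (hk : Primrec k) (hlab : Primrec lab)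
    (hacc : Primrec fun z : α × ℕ × ℕ => acc z.1 z.2.1 z.2.2) (hm : Primrec m) :
    Primrec fun z => cell (fun a b => unroll a b 0 (N z)) (l z) (k z) (lab z) (acc z) (m z) := by
  have acc' {β : Type} [Primcodable β] {a : β → α} {f g : β → ℕ} (ha : Primrec a)
      (hf : Primrec f) (hg : Primrec g) : Primrec fun z => acc (a z) (f z) (g z) :=
    hacc.comp (ha.pair (hf.pair hg))
  have left {f : α → ℕ} (hf : Primrec f) : Primrec fun z => (f z).unpair.1 :=
    fst.comp (unpair.comp hf)
  have right {f : α → ℕ} (hf : Primrec f) : Primrec fun z => (f z).unpair.2 :=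
    snd.comp (unpair.comp hf)
  have hx := right hm
  have hS := primrec_two_pow hk
  have tag (t : ℕ) : PrimrecPred fun z => (m z).unpair.1 = t :=
    PrimrecRel.comp Primrec.eq (left hm) (const t)
  have hr := right hx
  have hargs : Primrec fun z => Denumerable.ofNat (List ℕ) (m z).unpair.2.unpair.2 :=
    (Primrec.ofNat (List ℕ)).comp hr
  unfold cell
  refine ite (tag 0) (hS.pair hS) (ite (tag 1)
    (ite (primrecPred_mem hx hlab) (hS.pair hS) (const (0, 0))) (ite (tag 2) ?_
    (ite (tag 3) ?_ (ite (tag 4) (acc' .id hx (const 1)) (ite (tag 5) ?_ (ite (tag 6) ?_ ?_))))))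
  · exact (nat_sub.comp hS (snd.comp (acc' .id hx (const 0)))).pair
      (nat_sub.comp hS (fst.comp (acc' .id hx (const 0))))
  · exact (nat_min.comp (fst.comp (acc' .id (left hx) (const 0)))
        (fst.comp (acc' .id (right hx) (const 0)))).pair
      (nat_min.comp (snd.comp (acc' .id (left hx) (const 0)))
        (snd.comp (acc' .id (right hx) (const 0))))
  · exact (primrec_unroll
        (fst.comp (acc' fst ((right hx).comp fst) snd))
        (fst.comp (acc' fst ((left hx).comp fst) snd)) (const 0) hN).pair
      (primrec_unroll
        (snd.comp (acc' fst ((right hx).comp fst) snd))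
        (snd.comp (acc' fst ((left hx).comp fst) snd)) (const 0) hN)
  · have hi := (left hx).comp (fst (α := α) (β := ℕ))
    exact (primrec_unroll
        (primrec_loScale (α := α × ℕ) (hl.comp fst) (hk.comp fst) hi snd
          (fst.comp (acc' fst ((right hr).comp fst) snd)))
        (primrec_loScale (α := α × ℕ) (hl.comp fst) (hk.comp fst) hi snd
          (fst.comp (acc' fst ((left hr).comp fst) snd))) (const 0) hk).pair
      (primrec_unroll
        (primrec_hiScale (α := α × ℕ) (hl.comp fst) (hk.comp fst) hi snd
          (snd.comp (acc' fst ((right hr).comp fst) snd)))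
        (primrec_hiScale (α := α × ℕ) (hl.comp fst) (hk.comp fst) hi snd
          (snd.comp (acc' fst ((left hr).comp fst) snd)))
        (primrec_hiBound hl hk (primrec_query_eta (left hx) hk hk)) hk)
  · exact (primrec_loBound hl hk (primrec_query_opr (left hx)
        (list_map (g := fun z a => (acc z a 0).1) hargs
          (fst.comp (acc' fst snd (const 0)))) hk)).pair
      (primrec_hiBound hl hk (primrec_query_opr (left hx)
        (list_map (g := fun z a => (acc z a 0).2) hargs (snd.comp (acc' fst snd (const 0)))) hk))

variable {o : α → Lasso} {c : α → KripkeCode}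

theorem primrec_norm (ho : Primrec o) (hn : Primrec n) : Primrec fun z => (o z).norm (n z) := by
  have h1 := list_length.comp (fst.comp ho)
  have h2 := list_length.comp (snd.comp ho)
  exact ite (PrimrecRel.comp nat_lt hn h1) hn
    (nat_add.comp h1 (nat_mod.comp (nat_sub.comp hn h1) h2))

theorem primrec_word (ho : Primrec o) (hn : Primrec n) : Primrec fun z => (o z).word (n z) :=
  primrec_list_getD (list_append.comp (fst.comp ho) (snd.comp ho)) (primrec_norm ho hn) (const 0)

theorem primrec_labelsOf (hc : Primrec c) (hn : Primrec n) :
    Primrec fun z => labelsOf (c z) (n z) :=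
  snd.comp (primrec_list_getD hc hn (const ([], [])))

theorem primrec_successorsOf (hc : Primrec c) (hn : Primrec n) :
    Primrec fun z => successorsOf (c z) (n z) :=
  fst.comp (primrec_list_getD hc hn (const ([], [])))

theorem primrec_lasso_length (ho : Primrec o) :
    Primrec fun z => (o z).1.length + (o z).2.length :=
  nat_add.comp (list_length.comp (fst.comp ho)) (list_length.comp (snd.comp ho))

theorem primrec_column {tab : α → List (List Interval)} (ho : Primrec o) (hc : Primrec c)
    (hl : Primrec l) (hk : Primrec k) (htab : Primrec tab) (hm : Primrec m) :
    Primrec fun z => column (o z) (c z) (l z) (k z) (tab z) (m z) := by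
  refine list_map (list_range.comp (primrec_lasso_length ho)) (primrec_cell
    (α := α × ℕ)
    (acc := fun z m' n => ((tab z.1).getD m' []).getD ((o z.1).norm (z.2 + n)) (0, 0))
    ((primrec_lasso_length ho).comp fst) (hl.comp fst) (hk.comp fst)
    (primrec_labelsOf (hc.comp fst) (primrec_word (ho.comp fst) snd)) ?_ (hm.comp fst))
  exact primrec_list_getD
    (primrec_list_getD (htab.comp (fst.comp fst)) (fst.comp snd) (const []))
    (primrec_norm (ho.comp (fst.comp fst)) (nat_add.comp (snd.comp fst) (snd.comp snd)))
    (const (0, 0))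

theorem primrec_table (ho : Primrec o) (hc : Primrec c) (hl : Primrec l) (hk : Primrec k)
    (hm : Primrec m) : Primrec fun z => table (o z) (c z) (l z) (k z) (m z) := by
  refine (nat_rec' (g := fun _ => ([] : List (List Interval)))
    (h := fun z (p : ℕ × List (List Interval)) =>
      p.2 ++ [column (o z) (c z) (l z) (k z) p.2 p.1]) hm (const [])
    (list_append.comp (snd.comp snd) (list_cons.comp
      (primrec_column (ho.comp fst) (hc.comp fst) (hl.comp fst) (hk.comp fst) (snd.comp snd)
        (fst.comp snd)) (const [])))).of_eq fun z => ?_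
  induction m z with
  | zero => rfl
  | succ m ih => simp only [table, ← ih]

theorem primrec_lassoValue (ho : Primrec o) (hc : Primrec c) (hl : Primrec l) (hk : Primrec k)
    (hm : Primrec m) : Primrec fun z => lassoValue (o z) (c z) (l z) (k z) (m z) :=
  primrec_list_getD (primrec_list_getD (primrec_table ho hc hl hk (succ.comp hm)) hm (const []))
    (const 0) (const (0, 0))

theorem primrec_words {B : α → ℕ} (hn : Primrec n) (hB : Primrec B) :
    Primrec fun z => words (n z) (B z) := by
  refine (nat_rec' (g := fun _ => ([[]] : List (List ℕ)))
    (h := fun z (p : ℕ × List (List ℕ)) =>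
      [] :: p.2.flatMap fun w => (List.range (n z)).map fun a => a :: w) hB (const [[]])
    (list_cons.comp (const []) (list_flatMap (snd.comp snd)
      (list_map (list_range.comp (hn.comp (fst.comp fst)))
        (list_cons.comp snd (snd.comp fst)))))).of_eq fun z => ?_
  induction B z with
  | zero => rfl
  | succ m ih => simp only [words, ← ih]

theorem primrecPred_isPath (ho : Primrec o) (hc : Primrec c) :
    PrimrecPred fun z => (o z).IsPath (c z) := by
  refine PrimrecPred.and (PrimrecPred.not (PrimrecRel.comp Primrec.eq
    (list_length.comp (snd.comp ho)) (const 0))) ?_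
  refine (PrimrecRel.comp (PrimrecRel.forall_mem_list
    (R := fun (i : ℕ) (p : Lasso × KripkeCode) => p.1.word (i + 1) ∈ successorsOf p.2 (p.1.word i))
    (primrecPred_mem (primrec_word (fst.comp snd) (succ.comp fst))
      (primrec_successorsOf (snd.comp snd) (primrec_word (fst.comp snd) fst))))
    (list_range.comp (primrec_lasso_length ho)) (ho.pair hc)).of_eq fun z => ?_
  simp

theorem primrec_lassos {B : α → ℕ} (hc : Primrec c) (hB : Primrec B) :
    Primrec fun z => lassos (c z) (B z) := by
  have hw := primrec_words (list_length.comp hc) hB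
  exact (PrimrecRel.listFilter (R := fun (o : Lasso) (c : KripkeCode) => o.IsPath c)
    (primrecPred_isPath fst snd)).comp
    (list_flatMap hw (list_map (hw.comp fst) ((snd.comp fst).pair snd))) hc

theorem primrec_lassoBound (hc : Primrec c) (hm : Primrec m) (hk : Primrec k) :
    Primrec fun z => lassoBound (c z) (m z) (k z) := by
  have hS := succ.comp (primrec_two_pow hk)
  have ht : Primrec fun z => typeCount (c z) (m z) (k z) :=
    nat_mul.comp (list_length.comp hc) (primrec_pow.comp (nat_mul.comp hS hS)
      (nat_mul.comp (succ.comp hm) (succ.comp hk)))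
  exact nat_mul.comp ht (primrec_two_pow ht)

theorem primrecPred_isCertified {L : α → List Lasso} (hc : Primrec c) (hm : Primrec m)
    (hl : Primrec l) (hk : Primrec k) (hL : Primrec L) (ho : Primrec o) :
    PrimrecPred fun z => IsCertified (c z) (m z) (l z) (k z) (L z) (o z) := by
  refine (PrimrecRel.comp (PrimrecRel.forall_mem_list
    (R := fun (o' : Lasso) (p : (KripkeCode × ℕ) × (List ℕ × ℕ) × ℕ) =>
      (lassoValue o' p.1.1 p.2.1.1 p.2.1.2 p.1.2).2 ≤ p.2.2) ?_) hL
    (g := fun z => ((c z, m z), (l z, k z),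
      (lassoValue (o z) (c z) (l z) (k z) (m z)).1 + loBound (l z) (k z) (.margin (k z)))) ?_)
  · exact PrimrecRel.comp nat_le (snd.comp (primrec_lassoValue fst
      (fst.comp (fst.comp snd)) (fst.comp (fst.comp (snd.comp snd)))
      (snd.comp (fst.comp (snd.comp snd))) (snd.comp (fst.comp snd))))
      (snd.comp (snd.comp snd))
  · exact (hc.pair hm).pair ((hl.pair hk).pair (nat_add.comp
      (fst.comp (primrec_lassoValue ho hc hl hk hm))
      (primrec_loBound hl hk (primrec_query_margin hk))))

theorem primrec_schedulingStep : Primrec schedulingStep := by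
  have hc : Primrec fun x : Input × List ℕ => x.1.1 := fst.comp fst
  have hm : Primrec fun x : Input × List ℕ => x.1.2 := snd.comp fst
  have hk : Primrec fun x : Input × List ℕ => x.2.length.unpair.1 :=
    fst.comp (unpair.comp (list_length.comp snd))
  have hL := primrec_lassos hc (primrec_lassoBound hc hm hk)
  let R (o : Lasso) (p : (KripkeCode × ℕ) × (List ℕ × ℕ) × List Lasso) : Prop :=
    IsCertified p.1.1 p.1.2 p.2.1.1 p.2.1.2 p.2.2 o
  have hR : PrimrecRel R :=
    primrecPred_isCertified (fst.comp (fst.comp snd)) (snd.comp (fst.comp snd))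
      (fst.comp (fst.comp (snd.comp snd))) (snd.comp (fst.comp (snd.comp snd)))
      (snd.comp (snd.comp snd)) fst
  let _ : DecidableRel R := fun o p => by unfold R; infer_instance
  have h := hR.listFilter.comp hL ((hc.pair hm).pair ((snd.pair hk).pair hL))
  exact (list_head?.comp h).of_eq fun x => rfl

end Computability

/-! ### Interval semantics on infinite words -/

theorem unroll_succ (a b : ℕ → ℕ) (base N : ℕ) :
    unroll a b base (N + 1) =
      max (a 0) (min (b 0) (unroll (fun n => a (n + 1)) (fun n => b (n + 1)) base N)) := by
  simp [unroll, List.range_succ_eq_map, List.foldr_map]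

theorem le_unroll_iff {a b : ℕ → ℕ} {base N t : ℕ} :
    t ≤ unroll a b base N ↔
      (∃ i < N, t ≤ a i ∧ ∀ j < i, t ≤ b j) ∨ (t ≤ base ∧ ∀ j < N, t ≤ b j) := by
  induction N generalizing a b with
  | zero => simp [unroll]
  | succ N ih =>
    rw [unroll_succ, le_max_iff, le_min_iff, ih]
    constructor
    · rintro (h | ⟨h0, ⟨i, hi, h1, h2⟩ | ⟨h1, h2⟩⟩)
      · exact .inl ⟨0, by omega, h, by simp⟩
      · refine .inl ⟨i + 1, by omega, h1, fun j hj => ?_⟩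
        rcases j with _ | j
        exacts [h0, h2 j (by omega)]
      · refine .inr ⟨h1, fun j hj => ?_⟩
        rcases j with _ | j
        exacts [h0, h2 j (by omega)]
    · rintro (⟨i, hi, h1, h2⟩ | ⟨h1, h2⟩)
      · rcases i with _ | i
        · exact .inl h1
        · exact .inr ⟨h2 0 (by omega), .inl ⟨i, by omega, h1, fun j hj => h2 _ (by omega)⟩⟩
      · exact .inr ⟨h2 0 (by omega), .inr ⟨h1, fun j hj => h2 _ (by omega)⟩⟩

theorem unroll_congr {a b a' b' : ℕ → ℕ} {base N : ℕ} (ha : ∀ n < N, a n = a' n)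
    (hb : ∀ n < N, b n = b' n) : unroll a b base N = unroll a' b' base N := by
  induction N generalizing a b a' b' with
  | zero => rfl
  | succ N ih =>
    rw [unroll_succ, unroll_succ, ha 0 (by omega), hb 0 (by omega),
      ih (fun n hn => ha _ (by omega)) fun n hn => hb _ (by omega)]

open scoped Classical in
/-- The until operator for sequences of truth values in `{0, …, S}`: the largest threshold `t` for
which `t ≤ a` holds at some point and `t ≤ b` up to that point. -/
noncomputable def untl (S : ℕ) (a b : ℕ → ℕ) : ℕ :=
  Nat.findGreatest (fun t => ∃ i, t ≤ a i ∧ ∀ j < i, t ≤ b j) S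

theorem le_untl_iff {S t : ℕ} {a b : ℕ → ℕ} :
    t ≤ untl S a b ↔ t ≤ S ∧ ∃ i, t ≤ a i ∧ ∀ j < i, t ≤ b j := by
  classical
  constructor
  · intro h
    refine ⟨h.trans (Nat.findGreatest_le S), ?_⟩
    obtain ⟨i, h1, h2⟩ := Nat.findGreatest_spec (P := fun t => ∃ i, t ≤ a i ∧ ∀ j < i, t ≤ b j)
      (n := S) (Nat.zero_le S) ⟨0, by simp⟩
    exact ⟨i, h.trans h1, fun j hj => h.trans (h2 j hj)⟩
  · rintro ⟨h, h'⟩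
    exact Nat.le_findGreatest h h'

theorem untl_le (S : ℕ) (a b : ℕ → ℕ) : untl S a b ≤ S := (le_untl_iff.1 le_rfl).1

/-- The interval of the formula number `m` at the position `p` of the infinite word `w` of state
numbers. A proper subformula has a smaller number than the formula. -/
noncomputable def sem (c : KripkeCode) (l : List ℕ) (k : ℕ) (w : ℕ → ℕ) (m p : ℕ) : Interval :=
  cell (untl (2 ^ k)) l k (labelsOf c (w p))
    (fun m' n => if _ : m' < m then sem c l k w m' (p + n) else (0, 0)) m
termination_by m

theorem loBound_le (l : List ℕ) (k : ℕ) (q : Query) : loBound l k q ≤ 2 ^ k := min_le_left _ _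

theorem hiBound_le (l : List ℕ) (k : ℕ) (q : Query) : hiBound l k q ≤ 2 ^ k := min_le_left _ _

theorem loScale_le_of_le {l : List ℕ} {k i n x : ℕ} (hx : x ≤ 2 ^ k) : loScale l k i n x ≤ 2 ^ k :=
  Nat.div_le_of_le_mul (Nat.mul_le_mul (loBound_le _ _ _) hx)

theorem hiScale_le (l : List ℕ) (k i n x : ℕ) : hiScale l k i n x ≤ 2 ^ k := min_le_left _ _

theorem unroll_le {a b : ℕ → ℕ} {base N S : ℕ} (ha : ∀ n, a n ≤ S) (hb : base ≤ S) :
    unroll a b base N ≤ S := by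
  rcases le_unroll_iff.1 (le_refl (unroll a b base N)) with ⟨i, -, h, -⟩ | ⟨h, -⟩
  exacts [h.trans (ha i), h.trans hb]

theorem cell_le {U : (ℕ → ℕ) → (ℕ → ℕ) → ℕ} {l : List ℕ} {k : ℕ} {lab : List ℕ}
    {acc : ℕ → ℕ → Interval} {m : ℕ} (hU : ∀ a b, U a b ≤ 2 ^ k)
    (hacc : ∀ m' n, (acc m' n).1 ≤ 2 ^ k ∧ (acc m' n).2 ≤ 2 ^ k) :
    (cell U l k lab acc m).1 ≤ 2 ^ k ∧ (cell U l k lab acc m).2 ≤ 2 ^ k := by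
  unfold cell
  split_ifs
  · simp
  · simp
  · simp
  · simp
  · exact ⟨min_le_of_left_le (hacc _ _).1, min_le_of_left_le (hacc _ _).2⟩
  · exact hacc _ _
  · exact ⟨hU _ _, hU _ _⟩
  · exact ⟨unroll_le (fun n => loScale_le_of_le (hacc _ _).1) (Nat.zero_le _),
      unroll_le (fun n => hiScale_le _ _ _ _ _) (hiBound_le _ _ _)⟩
  · exact ⟨loBound_le _ _ _, hiBound_le _ _ _⟩

theorem sem_le (c : KripkeCode) (l : List ℕ) (k : ℕ) (w : ℕ → ℕ) (m p : ℕ) :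
    (sem c l k w m p).1 ≤ 2 ^ k ∧ (sem c l k w m p).2 ≤ 2 ^ k := by
  induction m using Nat.strong_induction_on generalizing p with
  | _ m ih =>
    rw [sem]
    refine cell_le (untl_le _) fun m' n => ?_
    split_ifs with h
    exacts [ih m' h _, by simp]

/-- The interval of a formula depends only on the intervals of its subformulas at the next `k + 2`
positions, except for the until operator. -/
theorem cell_congr {U U' : (ℕ → ℕ) → (ℕ → ℕ) → ℕ} {l : List ℕ} {k : ℕ} {lab : List ℕ}
    {acc acc' : ℕ → ℕ → Interval} {m : ℕ} (hacc : ∀ m', ∀ n ≤ k + 1, acc m' n = acc' m' n)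
    (hU : m.unpair.1 = 5 →
      U (fun n => (acc m.unpair.2.unpair.2 n).1) (fun n => (acc m.unpair.2.unpair.1 n).1) =
        U' (fun n => (acc' m.unpair.2.unpair.2 n).1) (fun n => (acc' m.unpair.2.unpair.1 n).1) ∧
      U (fun n => (acc m.unpair.2.unpair.2 n).2) (fun n => (acc m.unpair.2.unpair.1 n).2) =
        U' (fun n => (acc' m.unpair.2.unpair.2 n).2) (fun n => (acc' m.unpair.2.unpair.1 n).2)) :
    cell U l k lab acc m = cell U' l k lab acc' m := by
  have h0 : ∀ m', acc m' 0 = acc' m' 0 := fun m' => hacc m' 0 (by omega)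
  have h1 : ∀ m', acc m' 1 = acc' m' 1 := fun m' => hacc m' 1 (by omega)
  unfold cell
  simp only [h0, h1]
  split_ifs with _ _ _ _ _ _ h5
  any_goals rfl
  · exact Prod.ext (hU h5).1 (hU h5).2
  · have h : ∀ m', ∀ n < k, acc m' n = acc' m' n := fun m' n hn => hacc m' n (by omega)
    congr 1
    · exact unroll_congr (fun n hn => by simp only [h _ n hn]) fun n hn => by simp only [h _ n hn]
    · exact unroll_congr (fun n hn => by simp only [h _ n hn]) fun n hn => by simp only [h _ n hn]

/-! ### Correctness of the evaluation on lassos -/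

theorem Lasso.norm_lt {o : Lasso} (ho : o.2.length ≠ 0) (p : ℕ) :
    o.norm p < o.1.length + o.2.length := by
  unfold Lasso.norm
  split_ifs
  · omega
  · have := Nat.mod_lt (p - o.1.length) (Nat.pos_of_ne_zero ho)
    omega

theorem Lasso.norm_of_lt {o : Lasso} {p : ℕ} (hp : p < o.1.length + o.2.length) :
    o.norm p = p := by
  unfold Lasso.norm
  split_ifs
  · rfl
  · rw [Nat.mod_eq_of_lt (by omega)]; omega

theorem Lasso.norm_norm_add (o : Lasso) (p n : ℕ) : o.norm (o.norm p + n) = o.norm (p + n) := by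
  unfold Lasso.norm
  by_cases hp : p < o.1.length
  · simp only [hp, if_true]
  · have h1 : ¬ p + n < o.1.length := by omega
    have h2 : ¬ o.1.length + (p - o.1.length) % o.2.length + n < o.1.length := by omega
    simp only [hp, h1, h2, if_false]
    rw [show o.1.length + (p - o.1.length) % o.2.length + n - o.1.length =
      (p - o.1.length) % o.2.length + n by omega,
      show p + n - o.1.length = (p - o.1.length) + n by omega, Nat.mod_add_mod]

theorem Lasso.norm_norm (o : Lasso) (p : ℕ) : o.norm (o.norm p) = o.norm p :=
  o.norm_norm_add p 0

theorem Lasso.norm_add_length {o : Lasso} {p : ℕ} (hp : o.1.length ≤ p) :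
    o.norm (p + o.2.length) = o.norm p := by
  unfold Lasso.norm
  rw [if_neg (by omega), if_neg (by omega),
    show p + o.2.length - o.1.length = p - o.1.length + o.2.length by omega, Nat.add_mod_right]

theorem Lasso.word_norm (o : Lasso) (p : ℕ) : o.word (o.norm p) = o.word p := by
  rw [Lasso.word, Lasso.norm_norm, Lasso.word]

/-- On a sequence that is ultimately periodic, the until operator is determined within the length
of the lasso. -/
theorem unroll_eq_untl {S u v : ℕ} {a b : ℕ → ℕ} (hv : v ≠ 0) (hS : ∀ n, a n ≤ S)
    (ha : ∀ i, u ≤ i → a (i + v) = a i) : unroll a b 0 (u + v) = untl S a b := by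
  refine eq_of_forall_le_iff fun t => ?_
  rw [le_unroll_iff, le_untl_iff]
  constructor
  · rintro (⟨i, -, h⟩ | ⟨h, -⟩)
    · exact ⟨h.1.trans (hS i), i, h⟩
    · obtain rfl : t = 0 := by omega
      exact ⟨by omega, 0, by simp⟩
  · rintro ⟨-, h⟩
    classical
    refine .inl ⟨Nat.find h, ?_, Nat.find_spec h⟩
    by_contra! hlt
    -- the first witness cannot lie beyond the first period
    refine Nat.find_min h (m := Nat.find h - v) (by omega) ⟨?_, fun j hj => ?_⟩
    · rw [← ha _ (by omega), Nat.sub_add_cancel (by omega)]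
      exact (Nat.find_spec h).1
    · exact (Nat.find_spec h).2 j (by omega)

variable {o : Lasso} {c : KripkeCode} {l : List ℕ} {k : ℕ}

theorem length_table (m : ℕ) : (table o c l k m).length = m := by
  induction m with
  | zero => rfl
  | succ m ih => simp [table, ih]

theorem table_getD {m m' : ℕ} (h : m' < m) :
    (table o c l k m).getD m' [] = column o c l k (table o c l k m') m' := by
  induction m with
  | zero => omega
  | succ m ih =>
    rw [table]
    rcases Nat.lt_succ_iff_lt_or_eq.1 h with h | rfl
    · rw [List.getD_append _ _ _ _ (by rwa [length_table]), ih h]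
    · rw [List.getD_append_right _ _ _ _ (by rw [length_table]), length_table]
      simp

theorem column_getD (ho : o.2.length ≠ 0) (m p : ℕ) :
    (column o c l k (table o c l k m) m).getD (o.norm p) (0, 0) = sem c l k o.word m p := by
  induction m using Nat.strong_induction_on generalizing p with
  | _ m ih =>
    have hlt := o.norm_lt ho p
    have key : ∀ m' n, ((table o c l k m).getD m' []).getD (o.norm (o.norm p + n)) (0, 0) =
        if _ : m' < m then sem c l k o.word m' (p + n) else (0, 0) := by
      intro m' n
      split_ifs with h
      · rw [table_getD h, o.norm_norm_add, ih m' h]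
      · rw [List.getD_eq_default (l := table o c l k m) _ (by rw [length_table]; omega)]
        simp
    have hper : ∀ (m' n : ℕ), o.1.length ≤ n →
        (if _ : m' < m then sem c l k o.word m' (p + (n + o.2.length)) else (0, 0)) =
        if _ : m' < m then sem c l k o.word m' (p + n) else (0, 0) := by
      intro m' n hn
      split_ifs with h
      · rw [← ih m' h, ← ih m' h, ← add_assoc, Lasso.norm_add_length (by omega)]
      · rfl
    have hle : ∀ (m' n : ℕ),
        (if _ : m' < m then sem c l k o.word m' (p + n) else (0, 0)).1 ≤ 2 ^ k ∧
        (if _ : m' < m then sem c l k o.word m' (p + n) else (0, 0)).2 ≤ 2 ^ k := by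
      intro m' n
      split_ifs
      exacts [sem_le _ _ _ _ _ _, by simp]
    rw [column, List.getD_eq_getElem _ _ (by simpa using hlt), List.getElem_map,
      List.getElem_range, o.word_norm, sem]
    simp only [key]
    refine cell_congr (fun _ _ _ => rfl) fun _ => ⟨?_, ?_⟩
    · exact unroll_eq_untl ho (fun n => (hle _ n).1) fun n hn => by rw [hper _ n hn]
    · exact unroll_eq_untl ho (fun n => (hle _ n).2) fun n hn => by rw [hper _ n hn]

/-- The computed interval of a formula in a lasso is the one in the described sequence. -/
theorem lassoValue_eq_sem (ho : o.2.length ≠ 0) (m : ℕ) :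
    lassoValue o c l k m = sem c l k o.word m 0 := by
  rw [lassoValue, table_getD (Nat.lt_succ_self m), ← column_getD ho,
    Lasso.norm_of_lt (by omega)]

/-! ### Ultimately periodic sequences with the same local behaviour -/

/-- A walk in a finite graph can be replaced by one without repetitions. -/
theorem exists_short_walk {V : Type*} [Fintype V] (R : V → V → Prop) (n : ℕ) (f : ℕ → V)
    (hf : ∀ i < n, R (f i) (f (i + 1))) :
    ∃ (n' : ℕ) (f' : ℕ → V), n' ≤ Fintype.card V ∧ f' 0 = f 0 ∧ f' n' = f n ∧
      ∀ i < n', R (f' i) (f' (i + 1)) := by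
  induction n using Nat.strong_induction_on generalizing f with
  | _ n ih =>
    by_cases hn : n ≤ Fintype.card V
    · exact ⟨n, f, hn, rfl, rfl, hf⟩
    · obtain ⟨i, j, hij, hfij⟩ : ∃ i j : Fin n, i < j ∧ f i = f j := by
        obtain ⟨i, j, hne, h⟩ := Fintype.exists_ne_map_eq_of_card_lt (fun i : Fin n => f i)
          (by simpa using hn)
        rcases lt_or_gt_of_ne hne with h' | h'
        exacts [⟨i, j, h', h⟩, ⟨j, i, h', h.symm⟩]
      have hij' : (i : ℕ) < j := hij
      have hj := j.isLt
      -- cut out the closed walk between the positions `i` and `j`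
      obtain ⟨n', f', h1, h2, h3, h4⟩ := ih (n - (j - i)) (by omega)
        (fun q => if q ≤ i then f q else f (q + (j - i))) (fun q hq => by
          rcases lt_trichotomy q i with h | h | h
          · simp only [h.le, show q + 1 ≤ (i : ℕ) by omega, if_true]
            exact hf q (by omega)
          · subst h
            simp only [le_refl, if_true, show ¬ (i : ℕ) + 1 ≤ i by omega, if_false, hfij]
            rw [show (i : ℕ) + 1 + (j - i) = j + 1 by omega]
            exact hf j hj
          · simp only [show ¬ q ≤ (i : ℕ) by omega, show ¬ q + 1 ≤ (i : ℕ) by omega, if_false]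
            rw [show q + 1 + ((j : ℕ) - i) = q + (j - i) + 1 by omega]
            exact hf _ (by omega))
      refine ⟨n', f', h1, by simpa using h2, ?_, h4⟩
      rw [h3, if_neg (by omega), show n - ((j : ℕ) - i) + (j - i) = n by omega]

/-- Every sequence `T` in a finite type can be replaced by an ultimately periodic one, with short
preperiod and period, that has the same initial element, every two successive elements of which are
also successive in `T`, and in whose period every element occurs that occurs infinitely often
in `T`. -/
theorem exists_periodic_realization {τ : Type*} [Fintype τ] (T : ℕ → τ) :
    ∃ (a d : ℕ) (F : ℕ → τ), a ≤ Fintype.card τ ∧ d ≠ 0 ∧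
      d ≤ Fintype.card τ * 2 ^ Fintype.card τ ∧ F 0 = T 0 ∧
      (∀ q, ∃ p, T p = F q ∧ T (p + 1) = F (q + 1)) ∧
      (∀ i, F (a + i) = F (a + i % d)) ∧
      ∀ s, (∃ᶠ p in Filter.atTop, T p = s) → ∀ N, ∃ q ≥ N, F q = s := by
  classical
  obtain ⟨s₀, hs₀⟩ : ∃ s₀, ∃ᶠ p in Filter.atTop, T p = s₀ := by
    by_contra! h
    have h' : ∀ᶠ p in Filter.atTop, ∀ s, T p ≠ s :=
      Filter.eventually_all.2 h
    obtain ⟨p, hp⟩ := h'.exists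
    exact hp _ rfl
  let R : τ → τ → Prop := fun s s' => ∃ p, T p = s ∧ T (p + 1) = s'
  obtain ⟨N, hN⟩ := hs₀.exists
  obtain ⟨a, f, ha, hf0, hfa, hf⟩ := exists_short_walk R N T fun i _ => ⟨i, rfl, rfl⟩
  -- a closed walk through all elements that occur infinitely often
  have hocc : ∀ s, ∃ p ≥ N, (∃ᶠ p in Filter.atTop, T p = s) → T p = s := by
    intro s
    by_cases h : ∃ᶠ p in Filter.atTop, T p = s
    · obtain ⟨p, hp, hp'⟩ := Filter.frequently_atTop.1 h N
      exact ⟨p, hp, fun _ => hp'⟩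
    · exact ⟨N, le_rfl, fun h' => absurd h' h⟩
  choose occ hoccN hocc using hocc
  obtain ⟨M, hM, hTM⟩ := Filter.frequently_atTop.1 hs₀ (Finset.univ.sup occ + 1)
  have hoccM : ∀ s, occ s < M := fun s =>
    Nat.lt_of_lt_of_le (Nat.lt_succ_of_le (Finset.le_sup (Finset.mem_univ s))) hM
  -- shortened in a graph that also keeps track of the elements that have been visited
  obtain ⟨d, g, hd, hg0, hgd, hg⟩ := exists_short_walk
    (fun x y : τ × Finset τ => R x.1 y.1 ∧ y.2 = insert x.1 x.2) (M - N)
    (fun i => (T (N + i), (Finset.range i).image fun j => T (N + j)))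
    fun i _ => ⟨⟨N + i, rfl, rfl⟩, by simp [Finset.range_add_one, Finset.image_insert]⟩
  have hNM : N < M := (hoccN s₀).trans_lt (hoccM s₀)
  simp only [Nat.add_sub_cancel' hNM.le, hTM, add_zero, hN, Finset.range_zero,
    Finset.image_empty] at hg0 hgd
  have hvisit : ∀ i ≤ d, ∀ s ∈ (g i).2, ∃ j < i, (g j).1 = s := by
    intro i
    induction i with
    | zero => simp [hg0]
    | succ i ih =>
      intro hi s hs
      rw [(hg i (by omega)).2, Finset.mem_insert] at hs
      rcases hs with rfl | hs
      · exact ⟨i, by omega, rfl⟩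
      · obtain ⟨j, hj, h⟩ := ih (by omega) s hs
        exact ⟨j, by omega, h⟩
  have hall : ∀ s, (∃ᶠ p in Filter.atTop, T p = s) → ∃ j < d, (g j).1 = s := by
    intro s hs
    refine hvisit d le_rfl s ?_
    rw [hgd]
    have h1 := hoccN s
    have h2 := hoccM s
    refine Finset.mem_image.2 ⟨occ s - N, by simp; omega, ?_⟩
    rw [Nat.add_sub_cancel' h1, hocc s hs]
  have hd0 : d ≠ 0 := by
    obtain ⟨j, hj, -⟩ := hall s₀ hs₀
    omega
  have hF : ∀ i, (if a + i < a then f (a + i) else (g ((a + i - a) % d)).1) = (g (i % d)).1 := by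
    intro i
    rw [if_neg (by omega), Nat.add_sub_cancel_left]
  refine ⟨a, d, fun q => if q < a then f q else (g ((q - a) % d)).1, ha, hd0, by simpa using hd,
    ?_, fun q => ?_, fun i => ?_, fun s hs n => ?_⟩
  · by_cases h : 0 < a
    · simp [h, hf0]
    · obtain rfl : a = 0 := by omega
      simp [hg0, ← hf0, hfa, hN]
  · change R _ _
    rcases lt_trichotomy (q + 1) a with h | h | h
    · simpa [h, show q < a by omega] using hf q (by omega)
    · have := hf q (by omega)
      rw [h, hfa, hN] at this
      simpa [h, show q < a by omega, hg0] using this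
    · have hr := Nat.mod_lt (q - a) (Nat.pos_of_ne_zero hd0)
      have := (hg _ hr).1
      simp only [show ¬ q < a by omega, show ¬ q + 1 < a by omega, if_false]
      rw [show q + 1 - a = q - a + 1 by omega, Nat.add_mod]
      rcases Nat.lt_or_ge ((q - a) % d + 1) d with h' | h'
      · rwa [Nat.mod_eq_of_lt (a := 1) (by omega), Nat.mod_eq_of_lt h']
      · have h1 : (q - a) % d + 1 = d := by omega
        rw [h1, hgd] at this
        have h2 : ((q - a) % d + 1 % d) % d = 0 := by
          rw [Nat.add_mod_mod, h1, Nat.mod_self]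
        rwa [h2, hg0]
  · simp only [hF, Nat.mod_mod]
  · obtain ⟨j, hj, rfl⟩ := hall s hs
    refine ⟨a + (d * n + j), ?_, ?_⟩
    · have := Nat.le_mul_of_pos_left n (Nat.pos_of_ne_zero hd0)
      omega
    · simp only [hF, Nat.mul_add_mod, Nat.mod_eq_of_lt hj]

/-! ### Transfer of the interval semantics -/

theorem le_untl_step {S t q : ℕ} {a b : ℕ → ℕ} :
    t ≤ untl S (fun n => a (q + n)) (fun n => b (q + n)) ↔
      t ≤ S ∧ (t ≤ a q ∨
        (t ≤ b q ∧ t ≤ untl S (fun n => a (q + 1 + n)) (fun n => b (q + 1 + n)))) := by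
  simp only [le_untl_iff]
  constructor
  · rintro ⟨hS, i, h1, h2⟩
    rcases i with _ | i
    · exact ⟨hS, .inl h1⟩
    · exact ⟨hS, .inr ⟨h2 0 (by omega), hS, i, by rwa [add_right_comm, add_assoc],
        fun j hj => by rw [add_right_comm, add_assoc]; exact h2 _ (by omega)⟩⟩
  · rintro ⟨hS, h | ⟨h, -, i, h1, h2⟩⟩
    · exact ⟨hS, 0, h, by simp⟩
    · refine ⟨hS, i + 1, by rwa [add_right_comm, add_assoc] at h1, fun j hj => ?_⟩
      rcases j with _ | j
      · exact h
      · have := h2 j (by omega)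
        rwa [add_right_comm, add_assoc] at this

/-- If the positions `h 0, h 1, …` of a word follow each other as far as the value `V` of an until
formula is concerned, then this value is correct in the word `h 0, h 1, …` too. The fairness
condition excludes that the fulfilment of the formula is postponed forever. -/
theorem untl_comp_eq {S : ℕ} {a b : ℕ → ℕ} {h : ℕ → ℕ} {V : ℕ → ℕ}
    (hV : ∀ q, V q = untl S (fun n => a (q + n)) (fun n => b (q + n)))
    (hstep : ∀ q, V (h q + 1) = V (h (q + 1)))
    (hfair : ∀ᶠ p in Filter.atTop, ∀ N, ∃ q ≥ N, a (h q) = a p ∧ V (h q) = V p) (p : ℕ) :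
    untl S (fun n => a (h (p + n))) (fun n => b (h (p + n))) = V (h p) := by
  have key : ∀ q t, t ≤ V (h q) ↔ t ≤ S ∧ (t ≤ a (h q) ∨ (t ≤ b (h q) ∧ t ≤ V (h (q + 1)))) := by
    intro q t
    rw [← hstep, hV, hV, le_untl_step]
  refine eq_of_forall_le_iff fun t => ?_
  rw [le_untl_iff]
  constructor
  · rintro ⟨hS, i, h1, h2⟩
    induction i generalizing p with
    | zero => exact (key p t).2 ⟨hS, .inl h1⟩
    | succ i ih =>
      refine (key p t).2 ⟨hS, .inr ⟨h2 0 (by omega), ih (p + 1) ?_ fun j hj => ?_⟩⟩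
      · rwa [add_right_comm, add_assoc]
      · rw [add_right_comm, add_assoc]
        exact h2 _ (by omega)
  · intro ht
    refine ⟨((key p t).1 ht).1, ?_⟩
    by_contra! hne
    have hpost : ∀ n, t ≤ V (h (p + n)) ∧ ∀ j < n, t ≤ b (h (p + j)) := by
      intro n
      induction n with
      | zero => simpa using ht
      | succ n ih =>
        rcases (key _ t).1 ih.1 with ⟨-, h1 | ⟨h1, h2⟩⟩
        · obtain ⟨j, hj, hlt⟩ := hne n h1
          exact absurd (ih.2 j hj) (by omega)
        · refine ⟨h2, fun j hj => ?_⟩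
          rcases Nat.lt_succ_iff_lt_or_eq.1 hj with h' | rfl
          exacts [ih.2 j h', h1]
    obtain ⟨p₀, hp₀⟩ := Filter.eventually_atTop.1 hfair
    obtain ⟨p₁, hp₁, hful⟩ : ∃ p₁ ≥ p₀, t ≤ V p₁ → t ≤ a p₁ := by
      by_cases h0 : t ≤ V p₀
      · rw [hV, le_untl_iff] at h0
        obtain ⟨-, i, hi, -⟩ := h0
        exact ⟨p₀ + i, by omega, fun _ => hi⟩
      · exact ⟨p₀, le_rfl, fun h => absurd h h0⟩
    obtain ⟨q, hq, h1, h2⟩ := hp₀ p₁ hp₁ p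
    obtain ⟨n, rfl⟩ := Nat.exists_eq_add_of_le hq
    have hn := hpost n
    obtain ⟨j, hj, hlt⟩ := hne n (by rw [h1]; exact hful (h2 ▸ hn.1))
    exact absurd (hn.2 j hj) (by omega)

/-- Let `w'` be the word of the states of `w` at the positions `h 0, h 1, …`. If these follow each
other as far as the intervals of the subformulas are concerned, and the intervals that recur in `w`
recur at these positions, then the subformulas have the same intervals in `w'` as in `w`. -/
theorem sem_comp_eq {c : KripkeCode} {l : List ℕ} {k M : ℕ} {w h : ℕ → ℕ}
    (hstep : ∀ q, ∀ m ≤ M, ∀ n ≤ k, sem c l k w m (h q + 1 + n) = sem c l k w m (h (q + 1) + n))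
    (hfair : ∀ᶠ p in Filter.atTop, ∀ N, ∃ q ≥ N, ∀ m ≤ M,
      sem c l k w m (h q) = sem c l k w m p)
    {m : ℕ} (hm : m ≤ M) (p : ℕ) : sem c l k (fun q => w (h q)) m p = sem c l k w m (h p) := by
  have window : ∀ m ≤ M, ∀ n ≤ k + 1, ∀ q,
      sem c l k w m (h q + n) = sem c l k w m (h (q + n)) := by
    intro m hm n
    induction n with
    | zero => simp
    | succ n ih =>
      intro hn q
      rw [show h q + (n + 1) = h q + 1 + n by omega, hstep q m hm n (by omega),
        ih (by omega) (q + 1), show q + 1 + n = q + (n + 1) by omega]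
  induction m using Nat.strong_induction_on generalizing p with
  | _ m ih =>
    have hacc : ∀ m' n, (if _ : m' < m then sem c l k (fun q => w (h q)) m' (p + n) else (0, 0)) =
        if _ : m' < m then sem c l k w m' (h (p + n)) else (0, 0) := by
      intro m' n
      split_ifs with hlt
      exacts [ih m' hlt (by omega) _, rfl]
    rw [sem, sem]
    simp only [hacc]
    refine cell_congr (fun m' n hn => ?_) fun h5 => ?_
    · split_ifs with hlt
      exacts [(window m' (by omega) n hn p).symm, rfl]
    · have hV : ∀ q, sem c l k w m q = _ := fun q => by rw [sem, cell]
      simp only [h5, OfNat.ofNat_ne_zero, OfNat.ofNat_ne_one, Nat.reduceEqDiff, if_false,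
        if_true] at hV
      have hst : ∀ q, sem c l k w m (h q + 1) = sem c l k w m (h (q + 1)) :=
        fun q => hstep q m hm 0 (by omega)
      constructor
      · refine (untl_comp_eq (V := fun q => (sem c l k w m q).1)
          (a := fun q => (if _ : m.unpair.2.unpair.2 < m then
            sem c l k w m.unpair.2.unpair.2 q else (0, 0)).1)
          (b := fun q => (if _ : m.unpair.2.unpair.1 < m then
            sem c l k w m.unpair.2.unpair.1 q else (0, 0)).1)
          (fun q => by rw [hV]) (fun q => by rw [hst]) ?_ p).trans (by simp only [hV])
        refine hfair.mono fun p hp N => ?_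
        obtain ⟨q, hq, h'⟩ := hp N
        refine ⟨q, hq, ?_, by simp only [h' m hm]⟩
        split_ifs with hlt
        exacts [by rw [h' _ (by omega)], rfl]
      · refine (untl_comp_eq (V := fun q => (sem c l k w m q).2)
          (a := fun q => (if _ : m.unpair.2.unpair.2 < m then
            sem c l k w m.unpair.2.unpair.2 q else (0, 0)).2)
          (b := fun q => (if _ : m.unpair.2.unpair.1 < m then
            sem c l k w m.unpair.2.unpair.1 q else (0, 0)).2)
          (fun q => by rw [hV]) (fun q => by rw [hst]) ?_ p).trans (by simp only [hV])
        refine hfair.mono fun p hp N => ?_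
        obtain ⟨q, hq, h'⟩ := hp N
        refine ⟨q, hq, ?_, by simp only [h' m hm]⟩
        split_ifs with hlt
        exacts [by rw [h' _ (by omega)], rfl]

theorem mem_words {n B : ℕ} {u : List ℕ} : u ∈ words n B ↔ u.length ≤ B ∧ ∀ a ∈ u, a < n := by
  induction B generalizing u with
  | zero => simp +contextual [words]
  | succ B ih =>
    rcases u with _ | ⟨a, u⟩
    · simp [words]
    · simp [words, ih]
      tauto

theorem mem_lassos {c : KripkeCode} {B : ℕ} {o : Lasso} :
    o ∈ lassos c B ↔ (o.1 ∈ words c.length B ∧ o.2 ∈ words c.length B) ∧ o.IsPath c := by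
  rcases o with ⟨u, v⟩
  simp [lassos]

/-- Every path has the same interval as one of the lassos of bounded size. -/
theorem exists_mem_lassos (c : KripkeCode) (l : List ℕ) (k m : ℕ) (w : ℕ → ℕ)
    (hw : ∀ p, w p < c.length) (hpath : ∀ p, w (p + 1) ∈ successorsOf c (w p)) :
    ∃ o ∈ lassos c (lassoBound c m k), sem c l k o.word m 0 = sem c l k w m 0 := by
  have hS := sem_le c l k w
  let T : ℕ → Fin c.length × (Fin (m + 1) × Fin (k + 1) → Fin (2 ^ k + 1) × Fin (2 ^ k + 1)) :=
    fun p => (⟨w p, hw p⟩, fun x =>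
      (⟨(sem c l k w x.1 (p + x.2)).1, Nat.lt_succ_of_le (hS _ _).1⟩,
        ⟨(sem c l k w x.1 (p + x.2)).2, Nat.lt_succ_of_le (hS _ _).2⟩))
  have hTw : ∀ p q, T p = T q → w p = w q := fun p q hpq =>
    congrArg (fun t => (t.1 : ℕ)) hpq
  have hT : ∀ p q, T p = T q → ∀ m' ≤ m, ∀ n ≤ k,
      sem c l k w m' (p + n) = sem c l k w m' (q + n) := by
    intro p q hpq m' hm' n hn
    have := congrFun (congrArg Prod.snd hpq) (⟨m', by omega⟩, ⟨n, by omega⟩)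
    simp only [T, Prod.mk.injEq, Fin.mk.injEq] at this
    exact Prod.ext this.1 this.2
  obtain ⟨a, d, F, ha, hd, hd', hF0, hF, hper, hrec⟩ := exists_periodic_realization T
  choose h hh hh' using hF
  have hcard : Fintype.card (Fin c.length ×
      (Fin (m + 1) × Fin (k + 1) → Fin (2 ^ k + 1) × Fin (2 ^ k + 1))) = typeCount c m k := by
    simp [typeCount]
  rw [hcard] at ha hd'
  have hstate : ∀ q, ((F q).1 : ℕ) = w (h q) := fun q => by rw [← hh q]
  let o : Lasso := (List.ofFn fun q : Fin a => ((F q).1 : ℕ),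
    List.ofFn fun q : Fin d => ((F (a + q)).1 : ℕ))
  have ho1 : o.1.length = a := List.length_ofFn
  have ho2 : o.2.length = d := List.length_ofFn
  have hword : o.word = fun q => w (h q) := by
    funext q
    rw [← hstate, Lasso.word, Lasso.norm, ho1, ho2]
    split_ifs with hq
    · rw [List.getD_append _ _ _ _ (by omega), List.getD_eq_getElem _ _ (by omega)]
      simp [o]
    · have := Nat.mod_lt (q - a) (Nat.pos_of_ne_zero hd)
      rw [List.getD_append_right _ _ _ _ (by omega), ho1, Nat.add_sub_cancel_left,
        List.getD_eq_getElem _ _ (by omega)]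
      simp only [o, List.getElem_ofFn]
      rw [← hper, Nat.add_sub_cancel' (by omega)]
  have hnext : ∀ q, w (h q + 1) = w (h (q + 1)) := fun q => hTw _ _ (by rw [hh', hh])
  refine ⟨o, mem_lassos.2 ⟨⟨mem_words.2 ⟨?_, ?_⟩, mem_words.2 ⟨?_, ?_⟩⟩, by omega, ?_⟩, ?_⟩
  · rw [ho1]
    exact ha.trans (Nat.le_mul_of_pos_right _ (by positivity))
  · intro s hs
    obtain ⟨q, rfl⟩ := List.mem_ofFn.1 hs
    exact Fin.isLt _
  · rw [ho2]
    exact hd'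
  · intro s hs
    obtain ⟨q, rfl⟩ := List.mem_ofFn.1 hs
    exact Fin.isLt _
  · intro q _
    simp only [hword, ← hnext]
    exact hpath _
  · rw [hword, sem_comp_eq (M := m) ?_ ?_ le_rfl]
    · exact hT _ _ (by rw [hh, hF0]) m le_rfl 0 (by omega)
    · intro q m' hm' n hn
      exact hT _ _ (by rw [hh', hh]) m' hm' n hn
    · -- all but finitely many positions have a type that occurs infinitely often
      have : ∀ᶠ p in Filter.atTop, ∀ s, T p = s → ∃ᶠ p' in Filter.atTop, T p' = s := by
        refine Filter.eventually_all.2 fun s => ?_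
        by_cases hs : ∃ᶠ p' in Filter.atTop, T p' = s
        · exact .of_forall fun _ _ => hs
        · exact (Filter.not_frequently.1 hs).mono fun p hp hp' => absurd hp' hp
      refine this.mono fun p hp N => ?_
      obtain ⟨q, hq, hFq⟩ := hrec _ (hp _ rfl) N
      exact ⟨q, hq, fun m' hm' => hT _ _ (by rw [hh, hFq]) m' hm' 0 (by omega)⟩

/-! ### Bounds from oracle answers -/

theorem prefix_getD (g : Oracle) (n i d : ℕ) :
    (g.prefix n).getD i d = if i < n then g i else d := by
  unfold Oracle.prefix
  split_ifs with h
  · rw [List.getD_eq_getElem _ _ (by simpa using h)]; simp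
  · rw [List.getD_eq_default _ _ (by simpa using h)]

theorem approximates_iff {g : Oracle} {q : Query} {k : ℕ} {x : ℝ} :
    g.Approximates q k x ↔ (g (Encodable.encode q) : ℝ) ≤ x * 2 ^ k + 1 ∧
      x * 2 ^ k ≤ g (Encodable.encode q) + 1 := by
  have hS : (0 : ℝ) < 2 ^ k := by positivity
  rw [Oracle.Approximates, ← mul_le_mul_iff_of_pos_right hS, ← abs_of_pos hS, ← abs_mul,
    abs_of_pos hS, sub_mul, div_mul_cancel₀ _ hS.ne', div_mul_cancel₀ _ hS.ne', abs_le]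
  constructor <;> rintro ⟨h1, h2⟩ <;> constructor <;> linarith

section Bounds

variable {g : Oracle} {q : Query} {k n : ℕ} {x : ℝ}

theorem loBound_sound (h : g.Approximates q k x) (hx : 0 ≤ x) :
    (loBound (g.prefix n) k q : ℝ) ≤ x * 2 ^ k := by
  have hS : (0 : ℝ) < 2 ^ k := by positivity
  rw [approximates_iff] at h
  have h1 : (loBound (g.prefix n) k q : ℝ) ≤
      ((g.prefix n).getD (Encodable.encode q) 0 - 1 : ℕ) := by
    exact_mod_cast min_le_right _ _
  refine h1.trans ?_
  rw [prefix_getD]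
  split_ifs
  · rcases Nat.eq_zero_or_pos (g (Encodable.encode q)) with h0 | h0
    · simp only [h0, zero_le, Nat.sub_eq_zero_of_le, Nat.cast_zero]; positivity
    · rw [Nat.cast_sub h0]; push_cast; linarith
  · simp only [zero_le, Nat.sub_eq_zero_of_le, Nat.cast_zero]; positivity

theorem hiBound_sound (h : g.Approximates q k x) (hx : x ≤ 1) :
    x * 2 ^ k ≤ hiBound (g.prefix n) k q := by
  have hS : (0 : ℝ) < 2 ^ k := by positivity
  have hxS : x * 2 ^ k ≤ 2 ^ k := by nlinarith
  rw [approximates_iff] at h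
  rw [hiBound, prefix_getD]
  push_cast
  refine le_min hxS ?_
  split_ifs
  · exact h.2
  · linarith

theorem hiBound_le_add_two (hn : Encodable.encode q < n) :
    hiBound (g.prefix n) k q ≤ loBound (g.prefix n) k q + 2 := by
  simp only [hiBound, loBound, prefix_getD, if_pos hn]
  omega

theorem hiBound_le_of_lt (h : g.Approximates q k x) (hn : Encodable.encode q < n) :
    (hiBound (g.prefix n) k q : ℝ) ≤ x * 2 ^ k + 2 := by
  rw [approximates_iff] at h
  have h1 : hiBound (g.prefix n) k q ≤ g (Encodable.encode q) + 1 := by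
    simp only [hiBound, prefix_getD, if_pos hn]; omega
  have h2 : (hiBound (g.prefix n) k q : ℝ) ≤ g (Encodable.encode q) + 1 := by exact_mod_cast h1
  linarith [h.1]

theorem le_loBound_of_lt (h : g.Approximates q k x) (hx : x ≤ 1) (hn : Encodable.encode q < n) :
    x * 2 ^ k ≤ loBound (g.prefix n) k q + 2 := by
  refine (hiBound_sound (n := n) h hx).trans ?_
  exact_mod_cast hiBound_le_add_two hn

end Bounds

/-! ### Soundness of the interval semantics -/

theorem coe_iSup_le {ι : Sort*} {f : ι → I} {y : ℝ} (hy : 0 ≤ y) (h : ∀ i, (f i : ℝ) ≤ y) :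
    ((⨆ i, f i : I) : ℝ) ≤ y := by
  by_cases h1 : 1 ≤ y
  · exact (⨆ i, f i : I).2.2.trans h1
  · have : (⨆ i, f i : I) ≤ ⟨y, hy, by linarith⟩ := iSup_le fun i => h i
    exact this

theorem le_until_of_exists {A B : ℕ → I} {x : ℝ} (hx : 0 ≤ x)
    (h : ∃ i, x ≤ A i ∧ ∀ j < i, x ≤ B j) :
    x ≤ ((⨆ i : ℕ, min (A i) (⨅ j : Fin i, B j) : I) : ℝ) := by
  obtain ⟨i, h1, h2⟩ := h
  have : (⟨x, hx, h1.trans (A i).2.2⟩ : I) ≤ ⨆ i : ℕ, min (A i) (⨅ j : Fin i, B j) :=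
    le_iSup_of_le i (le_min h1 (le_iInf fun j => h2 j j.isLt))
  exact this

theorem until_le_of_forall {A B : ℕ → I} {y : ℝ} (hy : 0 ≤ y)
    (h : ∀ (x : ℝ) (i : ℕ), x ≤ A i → (∀ j < i, x ≤ B j) → x ≤ y) :
    ((⨆ i : ℕ, min (A i) (⨅ j : Fin i, B j) : I) : ℝ) ≤ y := by
  refine coe_iSup_le hy fun i => h _ i ?_ fun j hj => ?_
  · exact min_le_left (A i) _
  · exact (min_le_right (A i) _).trans (iInf_le (fun j : Fin i => B j) ⟨j, hj⟩)

section Sem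

variable {c : KripkeCode} {l : List ℕ} {k : ℕ} {w : ℕ → ℕ}

theorem lt_pair {t x : ℕ} (ht : 0 < t) : x < Nat.pair t x := by
  have := Nat.add_le_pair t x
  omega

theorem lt_encode_of_mem {a : ℕ} {s : List ℕ} (h : a ∈ s) : a < Encodable.encode s := by
  induction s with
  | nil => simp at h
  | cons b s ih =>
    rw [Encodable.encode_list_cons, Nat.lt_succ_iff]
    rcases List.mem_cons.1 h with rfl | h
    · exact Nat.left_le_pair _ _
    · exact (ih h).le.trans (Nat.right_le_pair _ _)

theorem sem_tt (p : ℕ) : sem c l k w (Nat.pair 0 0) p = (2 ^ k, 2 ^ k) := by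
  rw [sem, cell]; simp

theorem sem_atom (i p : ℕ) : sem c l k w (Nat.pair 1 i) p =
    if i ∈ labelsOf c (w p) then (2 ^ k, 2 ^ k) else (0, 0) := by
  rw [sem, cell]; simp

theorem sem_neg (a p : ℕ) : sem c l k w (Nat.pair 2 a) p =
    (2 ^ k - (sem c l k w a p).2, 2 ^ k - (sem c l k w a p).1) := by
  rw [sem, cell]
  simp [lt_pair]

theorem sem_and (a b p : ℕ) : sem c l k w (Nat.pair 3 (Nat.pair a b)) p =
    (min (sem c l k w a p).1 (sem c l k w b p).1, min (sem c l k w a p).2 (sem c l k w b p).2) := by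
  have ha := (Nat.left_le_pair a b).trans_lt (lt_pair (t := 3) (by omega))
  have hb := (Nat.right_le_pair a b).trans_lt (lt_pair (t := 3) (by omega))
  rw [sem, cell]
  simp [ha, hb]

theorem sem_next (a p : ℕ) : sem c l k w (Nat.pair 4 a) p = sem c l k w a (p + 1) := by
  rw [sem, cell]
  simp [lt_pair]

theorem sem_untl (a b p : ℕ) : sem c l k w (Nat.pair 5 (Nat.pair a b)) p =
    (untl (2 ^ k) (fun n => (sem c l k w b (p + n)).1) (fun n => (sem c l k w a (p + n)).1),
      untl (2 ^ k) (fun n => (sem c l k w b (p + n)).2) fun n => (sem c l k w a (p + n)).2) := by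
  have ha := (Nat.left_le_pair a b).trans_lt (lt_pair (t := 5) (by omega))
  have hb := (Nat.right_le_pair a b).trans_lt (lt_pair (t := 5) (by omega))
  rw [sem, cell]
  simp [ha, hb]

theorem sem_duntl (i a b p : ℕ) : sem c l k w (Nat.pair 6 (Nat.pair i (Nat.pair a b))) p =
    (unroll (fun n => loScale l k i n (sem c l k w b (p + n)).1)
        (fun n => loScale l k i n (sem c l k w a (p + n)).1) 0 k,
      unroll (fun n => hiScale l k i n (sem c l k w b (p + n)).2)
        (fun n => hiScale l k i n (sem c l k w a (p + n)).2) (hiBound l k (.eta i k k)) k) := by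
  have h := (Nat.right_le_pair i (Nat.pair a b)).trans_lt (lt_pair (t := 6) (by omega))
  have ha := (Nat.left_le_pair a b).trans_lt h
  have hb := (Nat.right_le_pair a b).trans_lt h
  rw [sem, cell]
  simp [ha, hb]

theorem sem_op {r : ℕ} (j : ℕ) (a : Fin r → ℕ) (p : ℕ) :
    sem c l k w (Nat.pair 7 (Nat.pair j (Encodable.encode (List.ofFn a)))) p =
      (loBound l k (.opr j (List.ofFn fun i => (sem c l k w (a i) p).1) k),
        hiBound l k (.opr j (List.ofFn fun i => (sem c l k w (a i) p).2) k)) := by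
  have h := (Nat.right_le_pair j (Encodable.encode (List.ofFn a))).trans_lt
    (lt_pair (t := 7) (by omega))
  have ha : ∀ i, a i < Nat.pair 7 (Nat.pair j (Encodable.encode (List.ofFn a))) := fun i =>
    (lt_encode_of_mem (List.mem_ofFn.2 ⟨i, rfl⟩)).trans h
  rw [sem, cell]
  simp [ha, List.map_ofFn, Function.comp_def]

end Sem

theorem suffix_suffix {AP : Type u} (π : Computation AP) (i j : ℕ) :
    (π.suffix i).suffix j = π.suffix (i + j) := by
  funext n
  simp [Computation.suffix, add_assoc]

theorem loScale_sound {g : Oracle} {η : DiscountingFunction} {k i n N a : ℕ} {x : I}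
    (hη : g.NamesDiscounting i η) (ha : (a : ℝ) / 2 ^ k ≤ x) :
    (loScale (g.prefix N) k i n a : ℝ) / 2 ^ k ≤ (η.toFun n * x : I) := by
  have hS : (0 : ℝ) < 2 ^ k := by positivity
  have h1 := loBound_sound (n := N) (hη n k) (η.toFun n).2.1
  have h2 : (loScale (g.prefix N) k i n a : ℝ) ≤
      loBound (g.prefix N) k (.eta i n k) * a / 2 ^ k := by
    rw [loScale]
    refine Nat.cast_div_le.trans ?_
    push_cast
    exact le_rfl
  rw [div_le_iff₀ hS] at ha ⊢
  refine h2.trans ?_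
  rw [div_le_iff₀ hS]
  calc (loBound (g.prefix N) k (.eta i n k) : ℝ) * a
      ≤ ((η.toFun n : ℝ) * 2 ^ k) * (x * 2 ^ k) :=
        mul_le_mul h1 ha (by positivity) (mul_nonneg (η.toFun n).2.1 hS.le)
    _ = _ := by push_cast; ring

theorem hiScale_sound {g : Oracle} {η : DiscountingFunction} {k i n N a : ℕ} {x : I}
    (hη : g.NamesDiscounting i η) (ha : (x : ℝ) ≤ a / 2 ^ k) :
    ((η.toFun n * x : I) : ℝ) ≤ (hiScale (g.prefix N) k i n a : ℝ) / 2 ^ k := by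
  have hS : (0 : ℝ) < 2 ^ k := by positivity
  have h1 := hiBound_sound (n := N) (hη n k) (η.toFun n).2.2
  rw [le_div_iff₀ hS] at ha ⊢
  rw [hiScale]
  push_cast
  refine le_min ?_ ?_
  · have h := (η.toFun n * x).2.2
    push_cast at h
    nlinarith
  · have h2 : ((hiBound (g.prefix N) k (.eta i n k) * a : ℕ) : ℝ) / ((2 ^ k : ℕ) : ℝ) <
        ((hiBound (g.prefix N) k (.eta i n k) * a / 2 ^ k : ℕ) : ℝ) + 1 := by
      rw [← Nat.floor_div_eq_div (K := ℝ)]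
      exact Nat.lt_floor_add_one _
    refine le_trans ?_ h2.le
    push_cast
    rw [le_div_iff₀ hS]
    calc (η.toFun n : ℝ) * x * 2 ^ k * 2 ^ k = ((η.toFun n : ℝ) * 2 ^ k) * (x * 2 ^ k) := by ring
      _ ≤ _ := mul_le_mul h1 ha (mul_nonneg x.2.1 hS.le) (by positivity)

section Presentation

variable {AP : Type u} {W : Type v} {D : Set DiscountingFunction} {F : Set QualityOperator}
  {K : KripkeStructure AP W} {c : KripkeCode} {st : W ≃ Fin c.length} {g : Oracle}

/-- The interval semantics is sound, however little of the oracle is known. -/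
theorem sem_sound (hF : F ⊆ monotoneContinuousOperators) (φ : Formula AP D F) {m : ℕ}
    (hφ : CodesFormula K c st g φ m) (N k : ℕ) (ξ : ℕ → W) (p : ℕ) :
    ((sem c (g.prefix N) k (fun i => st (ξ i)) m p).1 : ℝ) / 2 ^ k ≤
        truthValue φ (Computation.suffix (fun i => K.label (ξ i)) p) ∧
      (truthValue φ (Computation.suffix (fun i => K.label (ξ i)) p) : ℝ) ≤
        ((sem c (g.prefix N) k (fun i => st (ξ i)) m p).2 : ℝ) / 2 ^ k := by
  have hS : (0 : ℝ) < 2 ^ k := by positivity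
  have hb := sem_le c (g.prefix N) k (fun i => st (ξ i))
  induction φ generalizing m p with
  | tt =>
    obtain rfl := hφ
    simp [sem_tt, truthValue]
  | atom q =>
    obtain ⟨i, hi, rfl⟩ := hφ
    have hlab : i ∈ labelsOf c (st (ξ p)) ↔ q ∈ K.label (ξ p) := by
      rw [hi (ξ p)]
      simp [labelsOf]
    by_cases hq : q ∈ K.label (ξ p)
    · rw [sem_atom, if_pos (hlab.2 hq)]
      simp [truthValue, Computation.suffix, hq]
    · rw [sem_atom, if_neg fun h => hq (hlab.1 h)]
      simp [truthValue, Computation.suffix, hq]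
  | neg φ ih =>
    obtain ⟨a, ha, rfl⟩ := hφ
    obtain ⟨h1, h2⟩ := ih ha p
    rw [sem_neg, truthValue, unitInterval.coe_symm_eq]
    simp only [Nat.cast_sub (hb a p).1, Nat.cast_sub (hb a p).2, sub_div, Nat.cast_pow,
      Nat.cast_ofNat, div_self hS.ne']
    constructor <;> linarith
  | and φ ψ ih1 ih2 =>
    obtain ⟨a, b, ha, hb', rfl⟩ := hφ
    obtain ⟨h1, h2⟩ := ih1 ha p
    obtain ⟨h3, h4⟩ := ih2 hb' p
    rw [sem_and, truthValue]
    have hco : ∀ x y : I, ((min x y : I) : ℝ) = min (x : ℝ) y := fun x y =>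
      Monotone.map_min (f := fun x : I => (x : ℝ)) fun _ _ h => h
    rw [hco]
    simp only [Nat.cast_min, ← min_div_div_right hS.le]
    exact ⟨min_le_min h1 h3, min_le_min h2 h4⟩
  | next φ ih =>
    obtain ⟨a, ha, rfl⟩ := hφ
    rw [sem_next, truthValue, suffix_suffix]
    exact ih ha (p + 1)
  | untl φ ψ ih1 ih2 =>
    obtain ⟨a, b, ha, hb', rfl⟩ := hφ
    rw [sem_untl, truthValue]
    simp only [suffix_suffix]
    constructor
    · obtain ⟨-, i, h1, h2⟩ := le_untl_iff.1 (le_refl (untl (2 ^ k)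
        (fun n => (sem c (g.prefix N) k (fun i => st (ξ i)) b (p + n)).1)
        fun n => (sem c (g.prefix N) k (fun i => st (ξ i)) a (p + n)).1))
      refine le_until_of_exists (by positivity) ⟨i, le_trans ?_ (ih2 hb' _).1,
        fun j hj => le_trans ?_ (ih1 ha _).1⟩
      · exact div_le_div_of_nonneg_right (by exact_mod_cast h1) hS.le
      · exact div_le_div_of_nonneg_right (by exact_mod_cast h2 j hj) hS.le
    · refine until_le_of_forall
          (A := fun n => truthValue ψ (Computation.suffix (fun i => K.label (ξ i)) (p + n)))
          (B := fun n => truthValue φ (Computation.suffix (fun i => K.label (ξ i)) (p + n)))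
          (div_nonneg (Nat.cast_nonneg _) hS.le) fun x i h1 h2 => ?_
      rw [le_div_iff₀ hS]
      refine (Nat.le_ceil _).trans (Nat.cast_le.2 (le_untl_iff.2 ⟨?_, i, ?_, fun j hj => ?_⟩))
      · rw [Nat.ceil_le]
        push_cast
        have := h1.trans (unitInterval.le_one _)
        nlinarith
      · rw [Nat.ceil_le, ← le_div_iff₀ hS]
        exact h1.trans (ih2 hb' _).2
      · rw [Nat.ceil_le, ← le_div_iff₀ hS]
        exact (h2 j hj).trans (ih1 ha _).2
  | duntl η φ ψ ih1 ih2 =>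
    obtain ⟨s, a, b, hη, ha, hb', rfl⟩ := hφ
    rw [sem_duntl, truthValue]
    simp only [suffix_suffix]
    constructor
    · rcases le_unroll_iff.1 (le_refl (unroll
        (fun n => loScale (g.prefix N) k s n
          (sem c (g.prefix N) k (fun i => st (ξ i)) b (p + n)).1)
        (fun n => loScale (g.prefix N) k s n
          (sem c (g.prefix N) k (fun i => st (ξ i)) a (p + n)).1) 0 k)) with
        ⟨i, -, h1, h2⟩ | ⟨h0, -⟩
      · refine le_until_of_exists
          (A := fun n => η.1.toFun n *
            truthValue ψ (Computation.suffix (fun i => K.label (ξ i)) (p + n)))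
          (B := fun n => η.1.toFun n *
            truthValue φ (Computation.suffix (fun i => K.label (ξ i)) (p + n)))
          (by positivity) ⟨i,
          le_trans ?_ (loScale_sound (N := N) hη (ih2 hb' _).1),
          fun j hj => le_trans ?_ (loScale_sound (N := N) hη (ih1 ha _).1)⟩
        · exact div_le_div_of_nonneg_right (by exact_mod_cast h1) hS.le
        · exact div_le_div_of_nonneg_right (by exact_mod_cast h2 j hj) hS.le
      · rw [Nat.le_zero.1 h0]
        simpa using unitInterval.nonneg _
    · refine until_le_of_forall
          (A := fun n => η.1.toFun n *
            truthValue ψ (Computation.suffix (fun i => K.label (ξ i)) (p + n)))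
          (B := fun n => η.1.toFun n *
            truthValue φ (Computation.suffix (fun i => K.label (ξ i)) (p + n)))
          (div_nonneg (Nat.cast_nonneg _) hS.le) fun x i h1 h2 => ?_
      rw [le_div_iff₀ hS]
      refine (Nat.le_ceil _).trans (Nat.cast_le.2 (le_unroll_iff.2 ?_))
      have hB : ∀ j < i, ⌈x * 2 ^ k⌉₊ ≤ hiScale (g.prefix N) k s j
          (sem c (g.prefix N) k (fun i => st (ξ i)) a (p + j)).2 := fun j hj => by
        rw [Nat.ceil_le, ← le_div_iff₀ hS]
        exact (h2 j hj).trans (hiScale_sound hη (ih1 ha _).2)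
      rcases Nat.lt_or_ge i k with hik | hik
      · refine .inl ⟨i, hik, ?_, hB⟩
        rw [Nat.ceil_le, ← le_div_iff₀ hS]
        exact h1.trans (hiScale_sound hη (ih2 hb' _).2)
      · -- beyond the horizon the value is at most `η k`
        refine .inr ⟨?_, fun j hj => hB j (hj.trans_le hik)⟩
        rw [Nat.ceil_le]
        refine le_trans ?_ (hiBound_sound (n := N) (hη k k) (η.1.toFun k).2.2)
        refine mul_le_mul_of_nonneg_right ?_ hS.le
        refine h1.trans ?_
        have h3 : η.1.toFun i ≤ η.1.toFun k := η.1.strictAnti.antitone hik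
        have h4 : η.1.toFun i *
            truthValue ψ (Computation.suffix (fun i => K.label (ξ i)) (p + i)) ≤ η.1.toFun i :=
          mul_le_of_le_one_right' (unitInterval.le_one _)
        exact h4.trans h3
  | op f φs ih =>
    obtain ⟨j, a, hj, ha, rfl⟩ := hφ
    obtain ⟨hmono, -⟩ := hF f.2
    rw [sem_op, truthValue]
    constructor
    · rw [div_le_iff₀ hS]
      refine (loBound_sound (n := N) (hj k fun i => ⟨(sem c (g.prefix N) k (fun i => st (ξ i))
        (a i) p).1, Nat.lt_succ_of_le (hb _ _).1⟩) (unitInterval.nonneg _)).trans ?_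
      refine mul_le_mul_of_nonneg_right (hmono fun i => ?_) hS.le
      exact (ih i (ha i) p).1
    · rw [le_div_iff₀ hS]
      refine le_trans ?_ (hiBound_sound (n := N) (hj k fun i =>
        ⟨(sem c (g.prefix N) k (fun i => st (ξ i)) (a i) p).2,
          Nat.lt_succ_of_le (hb _ _).2⟩) (unitInterval.le_one _))
      refine mul_le_mul_of_nonneg_right (hmono fun i => ?_) hS.le
      exact (ih i (ha i) p).2

end Presentation

/-! ### Convergence of the interval semantics -/

theorem untl_le_untl_add {S d : ℕ} {a b a' b' : ℕ → ℕ} (ha : ∀ n, a n ≤ a' n + d)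
    (hb : ∀ n, b n ≤ b' n + d) : untl S a b ≤ untl S a' b' + d := by
  obtain ⟨hS, i, h1, h2⟩ := le_untl_iff.1 (le_refl (untl S a b))
  rw [← Nat.sub_le_iff_le_add, le_untl_iff]
  refine ⟨by omega, i, ?_, fun j hj => ?_⟩
  · have := ha i; omega
  · have := hb j; have := h2 j hj; omega

theorem unroll_le_unroll_add {N d base base' : ℕ} {a b a' b' : ℕ → ℕ}
    (ha : ∀ n < N, a n ≤ a' n + d) (hb : ∀ n < N, b n ≤ b' n + d) (hbase : base ≤ base' + d) :
    unroll a b base N ≤ unroll a' b' base' N + d := by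
  rw [← Nat.sub_le_iff_le_add, le_unroll_iff]
  rcases le_unroll_iff.1 (le_refl (unroll a b base N)) with ⟨i, hi, h1, h2⟩ | ⟨h1, h2⟩
  · refine .inl ⟨i, hi, ?_, fun j hj => ?_⟩
    · have := ha i hi; omega
    · have := hb j (hj.trans hi); have := h2 j hj; omega
  · refine .inr ⟨by omega, fun j hj => ?_⟩
    have := hb j hj; have := h2 j hj; omega

theorem hiScale_le_loScale_add {g : Oracle} {n k i j x y d : ℕ}
    (hn : Encodable.encode (Query.eta i j k) < n) (hx : x ≤ 2 ^ k) (hxy : x ≤ y + d) :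
    hiScale (g.prefix n) k i j x ≤ loScale (g.prefix n) k i j y + (d + 4) := by
  have h1 := hiBound_le_add_two (g := g) (k := k) hn
  have h2 := loBound_le (g.prefix n) k (.eta i j k)
  have hS : 0 < 2 ^ k := by positivity
  refine (min_le_right _ _).trans ?_
  rw [loScale]
  generalize loBound (g.prefix n) k (.eta i j k) = lo at *
  generalize hiBound (g.prefix n) k (.eta i j k) = hi at *
  have h3 : hi * x ≤ lo * y + 2 ^ k * (d + 2) := by
    calc hi * x ≤ (lo + 2) * x := Nat.mul_le_mul_right _ h1
      _ = lo * x + 2 * x := by ring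
      _ ≤ lo * (y + d) + 2 * 2 ^ k :=
        Nat.add_le_add (Nat.mul_le_mul_left _ hxy) (Nat.mul_le_mul_left _ hx)
      _ = lo * y + lo * d + 2 * 2 ^ k := by ring
      _ ≤ lo * y + 2 ^ k * d + 2 * 2 ^ k := by gcongr
      _ = _ := by ring
  have h4 : hi * x / 2 ^ k ≤ lo * y / 2 ^ k + (d + 2) := by
    rw [← Nat.add_mul_div_left _ _ hS]
    exact Nat.div_le_div_right h3
  omega

/-- A constant number of units becomes negligible when the precision grows. -/
theorem eventually_le_mul_two_pow {δ : ℝ} (hδ : 0 < δ) (C : ℝ) :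
    ∀ᶠ k : ℕ in Filter.atTop, C ≤ δ * 2 ^ k :=
  ((tendsto_pow_atTop_atTop_of_one_lt one_lt_two).const_mul_atTop hδ).eventually_ge_atTop C

section Presentation

variable {AP : Type u} {W : Type v} {D : Set DiscountingFunction} {F : Set QualityOperator}
  {K : KripkeStructure AP W} {c : KripkeCode} {st : W ≃ Fin c.length} {g : Oracle}

/-- The intervals of a formula become arbitrarily narrow, uniformly in all words, if the precision
is large and sufficiently much, depending on the precision, of the oracle is known. -/
theorem sem_converges (hF : F ⊆ monotoneContinuousOperators) (φ : Formula AP D F) {m : ℕ}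
    (hφ : CodesFormula K c st g φ m) {δ : ℝ} (hδ : 0 < δ) :
    ∀ᶠ k in Filter.atTop, ∀ᶠ n in Filter.atTop, ∀ w p,
      (sem c (g.prefix n) k w m p).2 ≤ (sem c (g.prefix n) k w m p).1 + ⌊δ * 2 ^ k⌋₊ := by
  induction φ generalizing m δ with
  | tt =>
    obtain rfl := hφ
    exact .of_forall fun k => .of_forall fun n w p => by simp [sem_tt]
  | atom q =>
    obtain ⟨i, hi, rfl⟩ := hφ
    refine .of_forall fun k => .of_forall fun n w p => ?_
    rw [sem_atom]
    split_ifs <;> simp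
  | neg φ ih =>
    obtain ⟨a, ha, rfl⟩ := hφ
    filter_upwards [ih ha hδ] with k hk
    filter_upwards [hk] with n hn w p
    have := hn w p
    have := sem_le c (g.prefix n) k w a p
    rw [sem_neg]
    simp only
    omega
  | and φ ψ ih1 ih2 =>
    obtain ⟨a, b, ha, hb, rfl⟩ := hφ
    filter_upwards [ih1 ha hδ, ih2 hb hδ] with k hk1 hk2
    filter_upwards [hk1, hk2] with n hn1 hn2 w p
    have := hn1 w p
    have := hn2 w p
    rw [sem_and]
    simp only
    omega
  | next φ ih =>
    obtain ⟨a, ha, rfl⟩ := hφ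
    filter_upwards [ih ha hδ] with k hk
    filter_upwards [hk] with n hn w p
    rw [sem_next]
    exact hn w (p + 1)
  | untl φ ψ ih1 ih2 =>
    obtain ⟨a, b, ha, hb, rfl⟩ := hφ
    filter_upwards [ih1 ha hδ, ih2 hb hδ] with k hk1 hk2
    filter_upwards [hk1, hk2] with n hn1 hn2 w p
    rw [sem_untl]
    exact untl_le_untl_add (fun i => hn2 w _) fun i => hn1 w _
  | duntl η φ ψ ih1 ih2 =>
    obtain ⟨s, a, b, hη, ha, hb, rfl⟩ := hφ
    have hη0 : ∀ᶠ k in Filter.atTop, (η.1.toFun k : ℝ) < δ / 2 := by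
      have h : Filter.Tendsto (fun k => (η.1.toFun k : ℝ)) Filter.atTop (nhds ((0 : I) : ℝ)) :=
        (continuous_subtype_val.tendsto _).comp η.1.tendsto_zero
      exact h.eventually_lt_const (by simpa using hδ)
    filter_upwards [ih1 ha (half_pos hδ), ih2 hb (half_pos hδ), hη0,
      eventually_le_mul_two_pow (half_pos hδ) 4] with k hk1 hk2 hηk hk
    have hq : ∀ᶠ n in Filter.atTop, ∀ i ∈ Finset.range (k + 1),
        Encodable.encode (Query.eta s i k) < n :=
      (Filter.eventually_all_finset _).2 fun i _ => Filter.eventually_gt_atTop _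
    filter_upwards [hk1, hk2, hq] with n hn1 hn2 hq w p
    have hd : ⌊δ / 2 * 2 ^ k⌋₊ + 4 ≤ ⌊δ * 2 ^ k⌋₊ := by
      rw [← Nat.floor_add_ofNat (by positivity)]
      exact Nat.floor_le_floor (by linarith)
    rw [sem_duntl]
    refine unroll_le_unroll_add (fun i hi => ?_) (fun i hi => ?_) ?_
    · exact (hiScale_le_loScale_add (hq i (by simp; omega)) (sem_le _ _ _ _ _ _).2
        (hn2 w _)).trans (Nat.add_le_add_left hd _)
    · exact (hiScale_le_loScale_add (hq i (by simp; omega)) (sem_le _ _ _ _ _ _).2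
        (hn1 w _)).trans (Nat.add_le_add_left hd _)
    · rw [zero_add]
      refine Nat.le_floor ((hiBound_le_of_lt (hη k k) (hq k (by simp))).trans ?_)
      have hS : (0 : ℝ) < 2 ^ k := by positivity
      nlinarith
  | op f φs ih =>
    obtain ⟨j, a, hj, ha, rfl⟩ := hφ
    obtain ⟨-, hcont⟩ := hF f.2
    obtain ⟨θ, hθ, hunif⟩ := Metric.uniformContinuous_iff.1
      (CompactSpace.uniformContinuous_of_continuous hcont) (δ / 2) (half_pos hδ)
    filter_upwards [Filter.eventually_all.2 fun i => ih i (ha i) (half_pos hθ),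
      eventually_le_mul_two_pow (half_pos hδ) 4] with k hk hk4
    have hq : ∀ᶠ n in Filter.atTop, ∀ x : Fin f.1.arity → Fin (2 ^ k + 1),
        Encodable.encode (Query.opr j (List.ofFn fun i => (x i : ℕ)) k) < n :=
      Filter.eventually_all.2 fun x => Filter.eventually_gt_atTop _
    filter_upwards [Filter.eventually_all.2 hk, hq] with n hn hq w p
    have hS : (0 : ℝ) < 2 ^ k := by positivity
    have hle := sem_le c (g.prefix n) k w
    let x : Fin f.1.arity → Fin (2 ^ k + 1) := fun i =>
      ⟨(sem c (g.prefix n) k w (a i) p).1, Nat.lt_succ_of_le (hle _ _).1⟩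
    let y : Fin f.1.arity → Fin (2 ^ k + 1) := fun i =>
      ⟨(sem c (g.prefix n) k w (a i) p).2, Nat.lt_succ_of_le (hle _ _).2⟩
    -- the upper arguments, raised to the lower ones where they are below them
    let z : Fin f.1.arity → I := fun i => max (dyadicPoint k x i) (dyadicPoint k y i)
    have hz : dist z (dyadicPoint k x) < θ := by
      refine (dist_pi_lt_iff hθ).2 fun i => ?_
      have h1 : ((dyadicPoint k y i : I) : ℝ) ≤ (dyadicPoint k x i : I) + θ / 2 := by
        have h2 := hn i w p
        have h3 : ((y i : ℕ) : ℝ) ≤ (x i : ℕ) + θ / 2 * 2 ^ k := by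
          have h4 : ((y i : ℕ) : ℝ) ≤ (x i : ℕ) + (⌊θ / 2 * 2 ^ k⌋₊ : ℝ) := by exact_mod_cast h2
          exact h4.trans (add_le_add_right (Nat.floor_le (by positivity)) _)
        simp only [dyadicPoint]
        rw [div_le_iff₀ hS, add_mul, div_mul_cancel₀ _ hS.ne']
        exact h3
      rw [Subtype.dist_eq, Real.dist_eq]
      rcases le_total (dyadicPoint k x i) (dyadicPoint k y i) with h | h
      · have h' : ((dyadicPoint k x i : I) : ℝ) ≤ (dyadicPoint k y i : I) := h
        simp only [z, max_eq_right h]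
        rw [abs_of_nonneg (by linarith)]
        linarith
      · simp only [z, max_eq_left h, sub_self, abs_zero]
        exact hθ
    have hfz := hunif hz
    rw [Subtype.dist_eq, Real.dist_eq] at hfz
    have hfy : (f.1.toFun (dyadicPoint k y) : ℝ) ≤ f.1.toFun z :=
      (hF f.2).1 fun i => le_max_right _ _
    have h1 := hiBound_le_of_lt (hj k y) (hq y)
    have h2 := le_loBound_of_lt (hj k x) (unitInterval.le_one _) (hq x)
    have h3 := (abs_lt.1 hfz).2
    rw [sem_op]
    simp only
    rw [← Nat.sub_le_iff_le_add']
    refine Nat.le_floor ?_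
    rcases le_total (hiBound (g.prefix n) k (.opr j (List.ofFn fun i => (y i : ℕ)) k))
      (loBound (g.prefix n) k (.opr j (List.ofFn fun i => (x i : ℕ)) k)) with h | h
    · rw [Nat.sub_eq_zero_of_le h, Nat.cast_zero]
      positivity
    · rw [Nat.cast_sub h]
      nlinarith

end Presentation

/-! ### Correctness of the algorithm -/

section Presentation

variable {AP : Type u} {W : Type v} {D : Set DiscountingFunction} {F : Set QualityOperator}
  {K : KripkeStructure AP W} {c : KripkeCode} {st : W ≃ Fin c.length} {g : Oracle}

theorem rel_iff_mem_successorsOf (hK : CodesTransitions K c st) (s s' : W) :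
    K.rel s s' ↔ (st s' : ℕ) ∈ successorsOf c (st s) := by
  rw [hK s s']
  simp [successorsOf]

theorem suffix_zero (π : Computation AP) : π.suffix 0 = π := by
  funext n
  simp [Computation.suffix]

theorem Lasso.word_lt {o : Lasso} {B : ℕ} (ho : o ∈ lassos c B) (p : ℕ) :
    o.word p < c.length := by
  obtain ⟨⟨hu, hv⟩, hpath, -⟩ := mem_lassos.1 ho
  have hlt : o.norm p < (o.1 ++ o.2).length := by
    rw [List.length_append]
    exact o.norm_lt hpath p
  rw [Lasso.word, List.getD_eq_getElem _ _ hlt]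
  rcases List.mem_append.1 (List.getElem_mem hlt) with h | h
  exacts [(mem_words.1 hu).2 _ h, (mem_words.1 hv).2 _ h]

theorem Lasso.word_succ_mem {o : Lasso} (ho : o.IsPath c) (p : ℕ) :
    o.word (p + 1) ∈ successorsOf c (o.word p) := by
  have h := ho.2 _ (o.norm_lt ho.1 p)
  rwa [o.word_norm, ← o.word_norm (o.norm p + 1), o.norm_norm_add, o.word_norm] at h

/-- The sequence of states that a lasso describes. -/
def Lasso.path (st : W ≃ Fin c.length) (o : Lasso) (ho : ∀ p, o.word p < c.length) : ℕ → W :=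
  fun p => st.symm ⟨o.word p, ho p⟩

theorem Lasso.path_mem {o : Lasso} (hK : CodesTransitions K c st) (hpath : o.IsPath c)
    (ho : ∀ p, o.word p < c.length) : o.path st ho ∈ K.paths := by
  intro p
  rw [rel_iff_mem_successorsOf hK]
  simpa [Lasso.path] using Lasso.word_succ_mem hpath p

theorem Lasso.describes_path {o : Lasso} (hpath : o.IsPath c)
    (ho : ∀ p, o.word p < c.length) : o.Describes st (o.path st ho) := by
  refine ⟨fun h => hpath.1 (by simp [h]), fun i hi => ?_, fun i => ?_⟩
  · simp [Lasso.path, Lasso.word, Lasso.norm, hi, List.getElem?_append]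
  · have := Nat.mod_lt i (Nat.pos_of_ne_zero hpath.1)
    simp [Lasso.path, Lasso.word, Lasso.norm, this]

theorem lassoValue_fst_le (hF : F ⊆ monotoneContinuousOperators) {φ : Formula AP D F} {m : ℕ}
    (hφ : CodesFormula K c st g φ m) (N k : ℕ) {o : Lasso} (hpath : o.IsPath c)
    (ho : ∀ p, o.word p < c.length) :
    ((lassoValue o c (g.prefix N) k m).1 : ℝ) / 2 ^ k ≤ K.value φ (o.path st ho) := by
  have h := (sem_sound hF φ hφ N k (o.path st ho) 0).1
  rw [suffix_zero] at h
  rw [lassoValue_eq_sem hpath.1]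
  simpa [Lasso.path, KripkeStructure.value] using h

/-- The upper endpoints of the lassos of bounded size dominate the truth values in all paths. -/
theorem exists_lasso_value_le (hF : F ⊆ monotoneContinuousOperators) {φ : Formula AP D F} {m : ℕ}
    (hK : CodesTransitions K c st) (hφ : CodesFormula K c st g φ m) (N k : ℕ) {ξ : ℕ → W}
    (hξ : ξ ∈ K.paths) : ∃ o ∈ lassos c (lassoBound c m k),
      (K.value φ ξ : ℝ) ≤ ((lassoValue o c (g.prefix N) k m).2 : ℝ) / 2 ^ k := by
  obtain ⟨o, ho, hsem⟩ := exists_mem_lassos c (g.prefix N) k m (fun i => st (ξ i))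
    (fun p => Fin.isLt _) fun p => (rel_iff_mem_successorsOf hK _ _).1 (hξ p)
  refine ⟨o, ho, ?_⟩
  have h := (sem_sound hF φ hφ N k ξ 0).2
  rw [suffix_zero] at h
  rw [lassoValue_eq_sem (mem_lassos.1 ho).2.1, hsem]
  exact h

/-- Whatever the algorithm outputs is correct. -/
theorem isNearOptimal_of_isCertified (hF : F ⊆ monotoneContinuousOperators) {φ : Formula AP D F}
    {m : ℕ} {ε : ℝ} (hε : 0 < ε) (hK : CodesTransitions K c st) (hφ : CodesFormula K c st g φ m)
    (hmargin : g.NamesMargin ε) {N k : ℕ} {o : Lasso}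
    (hmem : o ∈ lassos c (lassoBound c m k))
    (hcert : IsCertified c m (g.prefix N) k (lassos c (lassoBound c m k)) o) :
    IsNearOptimal K φ ε (o.path st (Lasso.word_lt hmem)) := by
  have hS : (0 : ℝ) < 2 ^ k := by positivity
  have hpath := (mem_lassos.1 hmem).2
  have hlo := lassoValue_fst_le hF hφ N k hpath (Lasso.word_lt hmem)
  have hm := loBound_sound (n := N) (hmargin k) hε.le
  refine ⟨Lasso.path_mem hK hpath _, ?_⟩
  rw [sub_le_iff_le_add]
  refine coe_iSup_le (add_nonneg (unitInterval.nonneg _) hε.le) fun ξ => ?_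
  obtain ⟨o', ho', hξ⟩ := exists_lasso_value_le hF hK hφ N k ξ.2
  refine hξ.trans ?_
  have h : ((lassoValue o' c (g.prefix N) k m).2 : ℝ) ≤
      (lassoValue o c (g.prefix N) k m).1 + loBound (g.prefix N) k (.margin k) := by
    exact_mod_cast hcert o' ho'
  rw [div_le_iff₀ hS] at hlo ⊢
  rw [add_mul]
  linarith

theorem KripkeStructure.exists_path (K : KripkeStructure AP W) [Nonempty W] :
    ∃ ξ, ξ ∈ K.paths := by
  choose f hf using K.leftTotal
  refine ⟨fun i => f^[i] (Classical.arbitrary W), fun i => ?_⟩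
  simp only [Function.iterate_succ_apply']
  exact hf _

/-- The algorithm halts: if the intervals are narrower than the margin, then a lasso with the
largest upper bound is certified. -/
theorem exists_schedulingStep_isSome [Nonempty W] (hF : F ⊆ monotoneContinuousOperators)
    {φ : Formula AP D F} {m : ℕ} {ε : ℝ} (hε : 0 < ε) (hε1 : ε < 1)
    (hK : CodesTransitions K c st) (hφ : CodesFormula K c st g φ m) (hmargin : g.NamesMargin ε) :
    ∃ n, (schedulingStep ((c, m), g.prefix n)).isSome := by
  obtain ⟨k, hconv, hk⟩ := ((sem_converges hF φ hφ (half_pos hε)).and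
    (eventually_le_mul_two_pow (half_pos hε) 2)).exists
  obtain ⟨N, hN⟩ := Filter.eventually_atTop.1
    (hconv.and (Filter.eventually_gt_atTop (Encodable.encode (Query.margin k))))
  obtain ⟨hnarrow, hlt⟩ := hN (Nat.pair k N) (Nat.right_le_pair k N)
  refine ⟨Nat.pair k N, ?_⟩
  generalize hl : g.prefix (Nat.pair k N) = l at *
  have hlen : l.length.unpair.1 = k := by simp [← hl, Oracle.prefix]
  have hmar : ⌊ε / 2 * 2 ^ k⌋₊ ≤ loBound l k (.margin k) := by
    have h1 := le_loBound_of_lt (hmargin k) hε1.le hlt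
    rw [hl] at h1
    have h2 : (⌊ε / 2 * 2 ^ k⌋₊ : ℝ) ≤ ε / 2 * 2 ^ k := Nat.floor_le (by positivity)
    have h3 : (⌊ε / 2 * 2 ^ k⌋₊ : ℝ) ≤ loBound l k (.margin k) := by linarith
    exact_mod_cast h3
  obtain ⟨ξ, hξ⟩ := K.exists_path
  obtain ⟨o₀, ho₀, -⟩ := exists_lasso_value_le hF hK hφ 0 k hξ
  obtain ⟨o, ho, hmax⟩ := (lassos c (lassoBound c m k)).toFinset.exists_max_image
    (fun o => (lassoValue o c l k m).2) ⟨o₀, by simpa using ho₀⟩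
  simp only [List.mem_toFinset] at ho hmax
  rw [schedulingStep, List.isSome_head?]
  refine List.ne_nil_of_mem (a := o) (List.mem_filter.2 ⟨by simpa only [hlen] using ho, ?_⟩)
  simp only [hlen, decide_eq_true_eq]
  intro o' ho'
  have h := hnarrow o.word 0
  rw [← lassoValue_eq_sem (mem_lassos.1 ho).2.1] at h
  exact (hmax o' ho').trans (h.trans (Nat.add_le_add_left hmar _))

end Presentation

end DiscLTL

theorem mainTheorem1 (AP : Type u) (D : Set DiscLTL.DiscountingFunction)
    (F : Set DiscLTL.QualityOperator) (hF : F ⊆ DiscLTL.monotoneContinuousOperators) :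
    ∃ M : DiscLTL.OracleAlgorithm, DiscLTL.OracleAlgorithm.SolvesScheduling.{u, v} M AP D F := by
  classical
  refine ⟨⟨DiscLTL.schedulingStep, DiscLTL.primrec_schedulingStep.to_comp⟩, ?_⟩
  intro W _ K φ ε hε hε1 c st m g hK hφ hmargin
  have hhalt := DiscLTL.exists_schedulingStep_isSome hF hε hε1 hK hφ hmargin
  obtain ⟨o, ho⟩ := Option.isSome_iff_exists.1 (Nat.find_spec hhalt)
  refine ⟨o, ⟨Nat.find hhalt, ho, fun n hn => ?_⟩, ?_⟩
  · simpa using Nat.find_min hhalt hn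
  · have hmem := List.mem_filter.1 (List.mem_of_mem_head? ho)
    exact ⟨_, DiscLTL.Lasso.describes_path (DiscLTL.mem_lassos.1 hmem.1).2 _,
      DiscLTL.isNearOptimal_of_isCertified hF hε hK hφ hmargin hmem.1
        (of_decide_eq_true hmem.2)⟩
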